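/- Let $k$ be an infinite perfect field, let $B=\bigoplus_{n\ge 0}B_n$ be a standard graded $k$-algebra (that is, a nonzero commutative graded $k$-algebra with $B_0=k$, $\dim_k B_1<\infty$ and $B=k[B_1]$) of Krull dimension $d\ge 1$ with homogeneous maximal ideal $\mathfrak m=\bigoplus_{n\ge 1}B_n$, and let $s$ be a positive integer. Let $x_1,\dots,x_{d+s}$ be general linear forms in $B$; that is, there is a nonempty Zariski open subset $U$ of the affine space $B_1^{\,d+s}$ over $k$ such that the following holds for every $(x_1,\dots,x_{d+s})\in U$. One has $$\mathfrak m^n=(x_1,\dots,x_{d-1})\,\mathfrak m^{n-1}+(x_d,\dots,x_{d+s})^n\quad\text{for all } n\gg 0$$ if and only if for every minimal prime $\mathfrak q$ of $B$ with $\dim B/\mathfrak q=d$ the local ring $B_{\mathfrak q}$ has embedding dimension at most $s$, i.e. $\dim_{\kappa(\mathfrak q)}\,\mathfrak qB_{\mathfrak q}/\mathfrak q^2B_{\mathfrak q}\le s$. (For $d=1$ the ideal $(x_1,\dots,x_{d-1})$ is zero.) -/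

import Mathlib

open Filter

/-- A commutative graded algebra `B = ⨁ₙ 𝒜 n` over a field `k` is *standard graded* if it is nonzero,
`B₀ = k`, `B₁` is finite dimensional over `k`, and `B` is generated by `B₁` as a `k`-algebra. -/
structure IsStandardGraded {k B : Type*} [Field k] [CommRing B] [Algebra k B]
    (𝒜 : ℕ → Submodule k B) [GradedAlgebra 𝒜] : Prop where
  nontrivial : Nontrivial B
  degree_zero : 𝒜 0 = LinearMap.range (Algebra.linearMap k B)
  degree_one_finite : Module.Finite k (𝒜 1)
  adjoin_degree_one : Algebra.adjoin k (𝒜 1 : Set B) = ⊤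

/-- The value at `v` of a polynomial in linear forms on `V`. -/
noncomputable def polyEval {k V : Type*} [Field k] [AddCommGroup V] [Module k V]
    (f : MvPolynomial (Module.Dual k V) k) (v : V) : k :=
  MvPolynomial.eval (fun φ : Module.Dual k V => φ v) f

/-- Zariski open subsets of the set of `k`-points of the affine space `V`: complements of common
zero loci of sets of polynomial functions on `V`. -/
def IsZariskiOpen (k : Type*) {V : Type*} [Field k] [AddCommGroup V] [Module k V]
    (U : Set V) : Prop :=
  ∃ S : Set (MvPolynomial (Module.Dual k V) k), U = {v | ∃ f ∈ S, polyEval f v ≠ 0}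

/-- `P` holds for a general point of the affine space `V`: it holds on some nonempty Zariski open
subset of `V` (used over infinite fields only). -/
def HoldsForGeneral (k : Type*) {V : Type*} [Field k] [AddCommGroup V] [Module k V]
    (P : V → Prop) : Prop :=
  ∃ U : Set V, IsZariskiOpen k U ∧ U.Nonempty ∧ ∀ v ∈ U, P v

/-- The embedding dimension of a (Noetherian) local ring `R`: the dimension of `𝔪 / 𝔪²` over the
residue field. -/
noncomputable def embeddingDimension (R : Type*) [CommRing R] [IsLocalRing R] : ℕ :=
  Module.finrank (IsLocalRing.ResidueField R) (IsLocalRing.CotangentSpace R)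

/-! ### Standard graded algebras: ideals generated by forms and their graded pieces -/

section Graded

variable {k B : Type*} [Field k] [CommRing B] [Algebra k B]

/-! Let J be the span of x_1, …, x_{d-1} and Y the span of the other s + 1 forms. As 𝔪^n is
generated by B_n, the condition in degree n + 1 reads B_{n+1} = J B_n + Y^{n+1}. Once true it stays
true (`IsStandardGraded.le_succ`), and in a fixed degree it says that vectors depending polynomially
on the forms span B_{n+1}, which is open (`IsStandardGraded.exists_isZariskiOpen`). So sufficiency
needs only one good tuple; necessity is proved for every tuple.

Necessity (`IsStandardGraded.embeddingDimension_le`): the condition makes B finite over C = k[X_1,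
…, X_{d+s}]. Since dim B/q = d, some prime P ⊇ q contains J but not 𝔪, so it misses some x_j.
Multiplication by x_j^{n+1} sends B into JB plus the image of C, and Cayley–Hamilton
(`exists_smul_mem_range`) gives c ∈ C whose image is outside P with cB inside the image of C. Hence
the maximal ideal of B_q is generated by the image of that of the regular local ring C_p, p = q ∩ C,
which needs ht p ≤ (d + s) - d generators.

Sufficiency: as k is perfect, Der_k(B, κ(q)) has dimension at most d + s for each relevant q
(`finrank_derivation_le`). A linear form avoiding finitely many proper subspaces of B_1 lowers all
these dimensions while they are nonzero. One can moreover make x_1, …, x_d a Noether normalization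
and let one of y_1, …, y_s separate the geometric points over K = Frac k[x]
(`IsStandardGraded.exists_parameters`, `IsStandardGraded.exists_forms`). Then K ⊗ B is unramified
over K[y] and its geometric points are determined on K[y], so the two are equal
(`Subalgebra.eq_top_of_unramified`). Clearing denominators, fB ⊆ k[x, y] for a nonzero form f in the
x_i. Choose c with c_d = 1 and f(c) ≠ 0, and take J spanned by the x_i - c_i x_d, i < d. Modulo J, f
becomes f(c) x_d^e, and in large degrees everything is a multiple of x_d^e, so x_d and the y_j
generate (`IsStandardGraded.exists_graded_le`). -/

theorem mem_iSup_pow_of_mem_adjoin (L : Submodule k B) {b : B}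
    (hb : b ∈ Algebra.adjoin k (L : Set B)) : b ∈ ⨆ n : ℕ, L ^ n := by
  induction hb using Algebra.adjoin_induction with
  | mem x hx => exact Submodule.mem_iSup_of_mem 1 (by simpa using hx)
  | algebraMap r =>
    refine Submodule.mem_iSup_of_mem 0 ?_
    rw [pow_zero]
    exact Submodule.algebraMap_mem r
  | add x y _ _ hx hy => exact add_mem hx hy
  | mul x y _ _ hx hy =>
    have h := Submodule.mul_mem_mul hx hy
    rw [Submodule.iSup_mul] at h
    refine (iSup_le fun i => ?_ : _ ≤ ⨆ n : ℕ, L ^ n) h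
    rw [Submodule.mul_iSup]
    refine iSup_le fun j => ?_
    rw [← pow_add]
    exact le_iSup (fun n : ℕ => L ^ n) (i + j)

theorem pow_le_adjoin (L : Submodule k B) (n : ℕ) :
    L ^ n ≤ Subalgebra.toSubmodule (Algebra.adjoin k (L : Set B)) := by
  induction n with
  | zero =>
    rw [pow_zero]
    exact Submodule.one_le.mpr (one_mem (Algebra.adjoin k (L : Set B)))
  | succ n ih =>
    rw [pow_succ]
    exact Submodule.mul_le.mpr fun a ha b hb =>
      mul_mem (S := Subalgebra k B) (ih ha) (Algebra.subset_adjoin hb)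

theorem ideal_span_mul (M N : Submodule k B) :
    Ideal.span ((M * N : Submodule k B) : Set B) = Ideal.span (M : Set B) * Ideal.span (N : Set B) := by
  apply le_antisymm
  · rw [Ideal.span_le]
    intro x hx
    refine Submodule.mul_induction_on hx (fun m hm n hn => ?_) fun a b ha hb => add_mem ha hb
    exact Ideal.mul_mem_mul (Ideal.subset_span hm) (Ideal.subset_span hn)
  · rw [Ideal.span_mul_span', Ideal.span_le]
    rintro _ ⟨m, hm, n, hn, rfl⟩
    exact Ideal.subset_span (Submodule.mul_mem_mul hm hn)

theorem ideal_span_pow (M : Submodule k B) (n : ℕ) :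
    Ideal.span ((M ^ n : Submodule k B) : Set B) = Ideal.span (M : Set B) ^ n := by
  induction n with
  | zero =>
    rw [pow_zero, pow_zero, Ideal.one_eq_top, Ideal.eq_top_iff_one]
    exact Ideal.subset_span (Submodule.one_le.mp le_rfl)
  | succ n ih => rw [pow_succ, pow_succ, ideal_span_mul, ih]

theorem ideal_span_sup (M N : Submodule k B) :
    Ideal.span ((M ⊔ N : Submodule k B) : Set B) = Ideal.span (M : Set B) ⊔ Ideal.span (N : Set B) := by
  apply le_antisymm
  · rw [Ideal.span_le]
    intro x hx
    obtain ⟨m, hm, n, hn, rfl⟩ := Submodule.mem_sup.mp hx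
    exact Submodule.add_mem_sup (Ideal.subset_span hm) (Ideal.subset_span hn)
  · exact sup_le (Ideal.span_mono (le_sup_left : M ≤ M ⊔ N))
      (Ideal.span_mono (le_sup_right : N ≤ M ⊔ N))

theorem ideal_span_submodule_span (S : Set B) :
    Ideal.span ((Submodule.span k S : Submodule k B) : Set B) = Ideal.span S := by
  apply le_antisymm
  · rw [Ideal.span_le]
    have : Submodule.span k S ≤ (Ideal.span S).restrictScalars k :=
      Submodule.span_le.mpr Ideal.subset_span
    exact this
  · exact Ideal.span_mono Submodule.subset_span

variable (𝒜 : ℕ → Submodule k B) [GradedAlgebra 𝒜]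

theorem graded_mul_le (i j : ℕ) : 𝒜 i * 𝒜 j ≤ 𝒜 (i + j) :=
  Submodule.mul_le.mpr fun _ ha _ hb => SetLike.mul_mem_graded ha hb

variable {𝒜}

theorem pow_le_graded {L : Submodule k B} (hL : L ≤ 𝒜 1) (n : ℕ) : L ^ n ≤ 𝒜 n := by
  induction n with
  | zero =>
    rw [pow_zero]
    exact Submodule.one_le.mpr (SetLike.one_mem_graded 𝒜)
  | succ n ih =>
    rw [pow_succ]
    exact (mul_le_mul' ih hL).trans (graded_mul_le 𝒜 n 1)

theorem proj_of_mem {b : B} {n : ℕ} (hb : b ∈ 𝒜 n) : GradedRing.proj 𝒜 n b = b := by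
  rw [GradedRing.proj_apply, DirectSum.decompose_of_mem_same 𝒜 hb]

theorem proj_of_mem_ne {b : B} {n m : ℕ} (hb : b ∈ 𝒜 n) (h : n ≠ m) :
    GradedRing.proj 𝒜 m b = 0 := by
  rw [GradedRing.proj_apply, DirectSum.decompose_of_mem_ne 𝒜 hb h]

theorem proj_mem (n : ℕ) (b : B) : GradedRing.proj 𝒜 n b ∈ 𝒜 n := by
  rw [GradedRing.proj_apply]
  exact SetLike.coe_mem _

theorem proj_mem_of_mem_iSup {M : ℕ → Submodule k B} (hM : ∀ n, M n ≤ 𝒜 n) {b : B}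
    (hb : b ∈ ⨆ n, M n) (n : ℕ) : GradedRing.proj 𝒜 n b ∈ M n := by
  induction hb using Submodule.iSup_induction' with
  | mem i x hx =>
    by_cases h : i = n
    · subst h
      rwa [proj_of_mem (hM i hx)]
    · rw [proj_of_mem_ne (hM i hx) h]
      exact zero_mem _
  | zero => rw [map_zero]; exact zero_mem _
  | add x y _ _ hx hy => rw [map_add]; exact add_mem hx hy

theorem proj_mem_pow_of_mem_adjoin {L : Submodule k B} (hL : L ≤ 𝒜 1) {b : B}
    (hb : b ∈ Algebra.adjoin k (L : Set B)) (n : ℕ) : GradedRing.proj 𝒜 n b ∈ L ^ n :=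
  proj_mem_of_mem_iSup (pow_le_graded hL) (mem_iSup_pow_of_mem_adjoin L hb) n

theorem mem_pow_of_mem_adjoin {L : Submodule k B} (hL : L ≤ 𝒜 1) {b : B} {n : ℕ}
    (hb : b ∈ Algebra.adjoin k (L : Set B)) (hn : b ∈ 𝒜 n) : b ∈ L ^ n := by
  rw [← proj_of_mem hn]
  exact proj_mem_pow_of_mem_adjoin hL hb n

namespace IsStandardGraded

theorem pow_eq (hB : IsStandardGraded 𝒜) (n : ℕ) : 𝒜 1 ^ n = 𝒜 n := by
  refine le_antisymm (pow_le_graded le_rfl n) fun b hb => ?_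
  exact mem_pow_of_mem_adjoin le_rfl (by rw [hB.adjoin_degree_one]; trivial) hb

theorem graded_mul_eq (hB : IsStandardGraded 𝒜) (i j : ℕ) : 𝒜 i * 𝒜 j = 𝒜 (i + j) := by
  rw [← hB.pow_eq i, ← hB.pow_eq j, ← hB.pow_eq (i + j), pow_add]

theorem degree_zero_mul (hB : IsStandardGraded 𝒜) (L : Submodule k B) : 𝒜 0 * L = L := by
  rw [← hB.pow_eq 0, pow_zero, one_mul]

theorem finite_graded (hB : IsStandardGraded 𝒜) (n : ℕ) : Module.Finite k (𝒜 n) := by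
  have h1 : (𝒜 1).FG := by
    have := hB.degree_one_finite
    exact Module.Finite.iff_fg.mp this
  rw [Module.Finite.iff_fg, ← hB.pow_eq n]
  exact h1.pow n

theorem irrelevant_eq (hB : IsStandardGraded 𝒜) :
    (HomogeneousIdeal.irrelevant 𝒜).toIdeal = Ideal.span (𝒜 1 : Set B) := by
  apply le_antisymm
  · rw [HomogeneousIdeal.irrelevant_eq_span, Ideal.span_le]
    refine Set.iUnion₂_subset fun i hi b hb => ?_
    obtain ⟨j, rfl⟩ : ∃ j, i = j + 1 := ⟨i - 1, by omega⟩
    have hb' : b ∈ 𝒜 1 ^ (j + 1) := by rw [hB.pow_eq]; exact hb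
    rw [pow_succ] at hb'
    have h : b ∈ Ideal.span ((𝒜 1 ^ j * 𝒜 1 : Submodule k B) : Set B) := Ideal.subset_span hb'
    rw [ideal_span_mul] at h
    exact Ideal.mul_le_right h
  · rw [Ideal.span_le]
    exact fun b hb => HomogeneousIdeal.mem_irrelevant_of_mem 𝒜 one_pos hb

theorem irrelevant_pow (hB : IsStandardGraded 𝒜) (n : ℕ) :
    (HomogeneousIdeal.irrelevant 𝒜).toIdeal ^ n = Ideal.span (𝒜 n : Set B) := by
  rw [hB.irrelevant_eq, ← ideal_span_pow, hB.pow_eq]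

theorem finiteType (hB : IsStandardGraded 𝒜) : Algebra.FiniteType k B := by
  have h1 : (𝒜 1).FG := by
    have := hB.degree_one_finite
    exact Module.Finite.iff_fg.mp this
  obtain ⟨S, hS⟩ := h1
  refine ⟨S, ?_⟩
  rw [← hB.adjoin_degree_one, ← hS, Algebra.adjoin_span]

theorem isNoetherianRing (hB : IsStandardGraded 𝒜) : IsNoetherianRing B := by
  have := hB.finiteType
  exact Algebra.FiniteType.isNoetherianRing k B

end IsStandardGraded

/-- The graded piece of the ideal generated by a space of forms of degree `e`. -/
theorem proj_mem_mul_of_mem_span {e : ℕ} {L : Submodule k B} (hL : L ≤ 𝒜 e) {b : B}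
    (hb : b ∈ Ideal.span (L : Set B)) (n : ℕ) :
    GradedRing.proj 𝒜 (n + e) b ∈ 𝒜 n * L := by
  induction hb using Submodule.span_induction with
  | mem x hx =>
    by_cases h : n = 0
    · subst h
      rw [zero_add, proj_of_mem (hL hx)]
      simpa using Submodule.mul_mem_mul (SetLike.one_mem_graded 𝒜) hx
    · rw [proj_of_mem_ne (hL hx) (by omega)]
      exact zero_mem _
  | zero => rw [map_zero]; exact zero_mem _
  | add x y _ _ hx hy => rw [map_add]; exact add_mem hx hy
  | smul a x hx ih =>
    clear ih
    induction hx using Submodule.span_induction generalizing a with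
    | mem x hx =>
      rw [smul_eq_mul, GradedRing.proj_apply, DirectSum.coe_decompose_mul_add_of_right_mem 𝒜 (hL hx)]
      exact Submodule.mul_mem_mul (SetLike.coe_mem _) hx
    | zero => rw [smul_zero, map_zero]; exact zero_mem _
    | add x y _ _ hx hy => rw [smul_add, map_add]; exact add_mem (hx a) (hy a)
    | smul c x _ ih => rw [smul_smul]; exact ih _

theorem mem_mul_of_mem_span {e : ℕ} {L : Submodule k B} (hL : L ≤ 𝒜 e) {b : B} {n : ℕ}
    (hb : b ∈ Ideal.span (L : Set B)) (hbn : b ∈ 𝒜 (n + e)) : b ∈ 𝒜 n * L := by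
  rw [← proj_of_mem hbn]
  exact proj_mem_mul_of_mem_span hL hb n

/-- The degree `n + 1` part of the reduction condition, for spaces of linear forms. -/
theorem IsStandardGraded.irrelevant_pow_eq_iff (hB : IsStandardGraded 𝒜) {J Y : Submodule k B}
    (hJ : J ≤ 𝒜 1) (hY : Y ≤ 𝒜 1) (n : ℕ) :
    (HomogeneousIdeal.irrelevant 𝒜).toIdeal ^ (n + 1) =
        Ideal.span (J : Set B) * (HomogeneousIdeal.irrelevant 𝒜).toIdeal ^ n +
          Ideal.span (Y : Set B) ^ (n + 1) ↔
      𝒜 (n + 1) ≤ J * 𝒜 n ⊔ Y ^ (n + 1) := by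
  have hle : J * 𝒜 n ⊔ Y ^ (n + 1) ≤ 𝒜 (n + 1) := by
    refine sup_le ?_ (pow_le_graded hY _)
    rw [add_comm]
    exact (mul_le_mul' hJ le_rfl).trans (graded_mul_le 𝒜 1 n)
  have hR : Ideal.span (J : Set B) * (HomogeneousIdeal.irrelevant 𝒜).toIdeal ^ n +
      Ideal.span (Y : Set B) ^ (n + 1) =
      Ideal.span ((J * 𝒜 n ⊔ Y ^ (n + 1) : Submodule k B) : Set B) := by
    rw [ideal_span_sup, ideal_span_mul, ideal_span_pow, hB.irrelevant_pow, Submodule.add_eq_sup]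
  rw [hR, hB.irrelevant_pow]
  constructor
  · intro h b hb
    have hb' : b ∈ Ideal.span ((J * 𝒜 n ⊔ Y ^ (n + 1) : Submodule k B) : Set B) := by
      rw [← h]
      exact Ideal.subset_span hb
    have := mem_mul_of_mem_span (n := 0) hle hb' (by rwa [zero_add])
    rwa [hB.degree_zero_mul] at this
  · intro h
    rw [le_antisymm h hle]

/-- Multiply by B_1 and regroup Y^{n+1} B_1 as Y (B_1 Y^n) ⊆ Y B_{n+1}, to which the hypothesis
applies a second time. Hence a single degree suffices for all larger ones. -/
theorem IsStandardGraded.le_succ (hB : IsStandardGraded 𝒜) {J Y : Submodule k B}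
    (hY : Y ≤ 𝒜 1) {n : ℕ}
    (h : 𝒜 (n + 1) ≤ J * 𝒜 n ⊔ Y ^ (n + 1)) :
    𝒜 (n + 2) ≤ J * 𝒜 (n + 1) ⊔ Y ^ (n + 2) := by
  have e1 : 𝒜 1 * 𝒜 n = 𝒜 (n + 1) := by rw [hB.graded_mul_eq, add_comm]
  have e2 : 𝒜 1 * 𝒜 (n + 1) = 𝒜 (n + 2) := by rw [hB.graded_mul_eq]; congr 1; omega
  calc 𝒜 (n + 2) = 𝒜 1 * 𝒜 (n + 1) := e2.symm
    _ ≤ 𝒜 1 * (J * 𝒜 n ⊔ Y ^ (n + 1)) := mul_le_mul' le_rfl h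
    _ = J * 𝒜 (n + 1) ⊔ Y * (𝒜 1 * Y ^ n) := by
      rw [Submodule.mul_sup, ← e1, pow_succ']
      congr 1
      · rw [mul_left_comm]
      · rw [mul_left_comm]
    _ ≤ J * 𝒜 (n + 1) ⊔ Y * 𝒜 (n + 1) := by
      rw [← e1]
      exact sup_le_sup_left (mul_le_mul' le_rfl
        (mul_le_mul' le_rfl (pow_le_graded hY n))) _
    _ ≤ J * 𝒜 (n + 1) ⊔ Y * (J * 𝒜 n ⊔ Y ^ (n + 1)) :=
      sup_le_sup_left (mul_le_mul' le_rfl h) _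
    _ ≤ J * 𝒜 (n + 1) ⊔ Y ^ (n + 2) := by
      rw [Submodule.mul_sup, ← pow_succ', mul_left_comm]
      refine sup_le le_sup_left (sup_le_sup_right (mul_le_mul' le_rfl ?_) _)
      rw [← e1]
      exact mul_le_mul' hY le_rfl

theorem IsStandardGraded.eventually_of_le (hB : IsStandardGraded 𝒜) {J Y : Submodule k B}
    (hJ : J ≤ 𝒜 1) (hY : Y ≤ 𝒜 1) {n : ℕ}
    (h : 𝒜 (n + 1) ≤ J * 𝒜 n ⊔ Y ^ (n + 1)) :
    ∀ᶠ n : ℕ in atTop,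
      (HomogeneousIdeal.irrelevant 𝒜).toIdeal ^ n =
        Ideal.span (J : Set B) * (HomogeneousIdeal.irrelevant 𝒜).toIdeal ^ (n - 1) +
          Ideal.span (Y : Set B) ^ n := by
  have key : ∀ i, 𝒜 (n + i + 1) ≤ J * 𝒜 (n + i) ⊔ Y ^ (n + i + 1) := by
    intro i
    induction i with
    | zero => exact h
    | succ i ih => exact hB.le_succ hY ih
  filter_upwards [eventually_ge_atTop (n + 1)] with m hm
  obtain ⟨i, rfl⟩ : ∃ i, m = n + i + 1 := ⟨m - (n + 1), by omega⟩
  exact (hB.irrelevant_pow_eq_iff hJ hY _).mpr (key i)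

/-- The homogeneous core of a prime is prime and still contains I, so minimality forces equality. -/
theorem isHomogeneous_of_mem_minimalPrimes {I p : Ideal B} (hI : I.IsHomogeneous 𝒜)
    (hp : p ∈ I.minimalPrimes) : p.IsHomogeneous 𝒜 := by
  have hpp : p.IsPrime := hp.1.1
  have h1 : (p.homogeneousCore 𝒜).toIdeal.IsPrime := hpp.homogeneousCore
  have h2 : I ≤ (p.homogeneousCore 𝒜).toIdeal :=
    hI.toIdeal_homogeneousCore_eq_self.symm.trans_le (Ideal.homogeneousCore_mono _ hp.1.2)
  have h3 : (p.homogeneousCore 𝒜).toIdeal ≤ p := Ideal.toIdeal_homogeneousCore_le 𝒜 p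
  have h4 : (p.homogeneousCore 𝒜).toIdeal = p := le_antisymm h3 (hp.2 ⟨h1, h2⟩ h3)
  rw [← h4]
  exact HomogeneousIdeal.isHomogeneous _

theorem IsStandardGraded.le_irrelevant (hB : IsStandardGraded 𝒜) {I : Ideal B}
    (hI : I.IsHomogeneous 𝒜) (hne : I ≠ ⊤) : I ≤ (HomogeneousIdeal.irrelevant 𝒜).toIdeal := by
  intro b hb
  have h0 : GradedRing.proj 𝒜 0 b ∈ I := by
    rw [GradedRing.proj_apply]
    exact hI 0 hb
  have h1 : GradedRing.proj 𝒜 0 b ∈ LinearMap.range (Algebra.linearMap k B) := by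
    rw [← hB.degree_zero]
    exact proj_mem 0 b
  obtain ⟨c, hc⟩ := h1
  rw [HomogeneousIdeal.mem_iff, HomogeneousIdeal.mem_irrelevant_iff]
  by_contra hne'
  have hc0 : c ≠ 0 := by
    rintro rfl
    exact hne' (by rw [← hc, map_zero])
  apply hne
  rw [Ideal.eq_top_iff_one]
  have : algebraMap k B c⁻¹ * GradedRing.proj 𝒜 0 b ∈ I := I.mul_mem_left _ h0
  rwa [← hc, Algebra.linearMap_apply, ← map_mul, inv_mul_cancel₀ hc0, map_one] at this

theorem isHomogeneous_span_of_subset_graded {S : Set B} {e : ℕ} (hS : S ⊆ 𝒜 e) :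
    (Ideal.span S).IsHomogeneous 𝒜 :=
  Ideal.homogeneous_span 𝒜 S fun _ hx => ⟨e, hS hx⟩

/-- Graded Nakayama: if a power of the irrelevant ideal lies in `(x) + I`, then `B` is spanned
modulo `I` by finitely many elements over `k[x]`. -/
theorem IsStandardGraded.exists_fg_span (hB : IsStandardGraded 𝒜) {ι : Type*} {x : ι → B}
    (hx : ∀ i, x i ∈ 𝒜 1) {I : Ideal B} (hI : I.IsHomogeneous 𝒜) {N : ℕ}
    (hN : (𝒜 N : Set B) ⊆ (Ideal.span (Set.range x) ⊔ I : Ideal B)) :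
    ((Ideal.Quotient.mkₐ k I).comp (MvPolynomial.aeval x)).toRingHom.Finite := by
  set φ := ((Ideal.Quotient.mkₐ k I).comp (MvPolynomial.aeval x) :
    MvPolynomial ι k →ₐ[k] B ⧸ I) with hφ
  let : Algebra (MvPolynomial ι k) (B ⧸ I) := φ.toRingHom.toAlgebra
  have hT : IsScalarTower k (MvPolynomial ι k) (B ⧸ I) :=
    IsScalarTower.of_algebraMap_eq fun c => (φ.commutes c).symm
  have hfin : ∀ n, (𝒜 n).FG := fun n => Module.Finite.iff_fg.mp (hB.finite_graded n)
  choose F hF using hfin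
  set G : Set (B ⧸ I) := ⋃ n ∈ Finset.range (N + 1), (Ideal.Quotient.mk I) '' (F n) with hG
  have hGf : G.Finite := by
    refine Set.Finite.biUnion (Finset.finite_toSet _) fun n _ => ((F n).finite_toSet.image _)
  set M : Submodule (MvPolynomial ι k) (B ⧸ I) := Submodule.span _ G with hM
  have hxM : ∀ (i : ι) (b : B), Ideal.Quotient.mk I b ∈ M → Ideal.Quotient.mk I (x i * b) ∈ M := by
    intro i b hb
    have : Ideal.Quotient.mk I (x i * b) =
        (MvPolynomial.X i : MvPolynomial ι k) • Ideal.Quotient.mk I b := by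
      rw [Algebra.smul_def, map_mul]
      congr 1
      change _ = φ (MvPolynomial.X i)
      simp [hφ]
    rw [this]
    exact M.smul_mem _ hb
  have key : ∀ n, ∀ b ∈ 𝒜 n, Ideal.Quotient.mk I b ∈ M := by
    intro n
    induction n using Nat.strong_induction_on with
    | _ n ih =>
      by_cases hn : n < N + 1
      · intro b hb
        rw [← hF n] at hb
        induction hb using Submodule.span_induction with
        | mem y hy =>
          refine Submodule.subset_span ?_
          exact Set.mem_biUnion (by simpa using hn) ⟨y, hy, rfl⟩
        | zero => rw [map_zero]; exact zero_mem _
        | add y z _ _ hy hz => rw [map_add]; exact add_mem hy hz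
        | smul c y _ hy =>
          have : Ideal.Quotient.mk I (c • y) = c • Ideal.Quotient.mk I y := rfl
          rw [this]
          exact M.smul_of_tower_mem c hy
      · intro b hb
        obtain ⟨m, rfl⟩ : ∃ m, n = m + 1 := ⟨n - 1, by omega⟩
        -- Here m + 1 > N, so b is a combination of elements of B_N and lies in (x) + I. Its
        -- component of degree m + 1 has coefficients of degree m on the x_i, where induction
        -- applies.
        have hb' : b ∈ (Ideal.span (Set.range x) ⊔ I : Ideal B) := by
          obtain ⟨j, hj⟩ : ∃ j, m + 1 = j + N := ⟨m + 1 - N, by omega⟩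
          rw [hj, ← hB.graded_mul_eq] at hb
          refine Submodule.mul_induction_on hb (fun u _ v hv => ?_) fun u v hu hv => add_mem hu hv
          exact Ideal.mul_mem_left _ _ (hN hv)
        obtain ⟨u, hu, v, hv, rfl⟩ := Submodule.mem_sup.mp hb'
        have huv : GradedRing.proj 𝒜 (m + 1) (u + v) = u + v := proj_of_mem hb
        have hv' : GradedRing.proj 𝒜 (m + 1) v ∈ I := by
          rw [GradedRing.proj_apply]
          exact hI _ hv
        rw [← huv, map_add, map_add, Ideal.Quotient.eq_zero_iff_mem.mpr hv', add_zero]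
        rw [← ideal_span_submodule_span (k := k)] at hu
        have hL : Submodule.span k (Set.range x) ≤ 𝒜 1 :=
          Submodule.span_le.mpr (by rintro _ ⟨i, rfl⟩; exact hx i)
        have hu' := proj_mem_mul_of_mem_span hL hu m
        generalize GradedRing.proj 𝒜 (m + 1) u = w at hu'
        refine Submodule.mul_induction_on hu' (fun a ha c hc => ?_) fun y z hy hz => by
          rw [map_add]; exact add_mem hy hz
        have ha' := ih m (by omega) a ha
        induction hc using Submodule.span_induction with
        | mem y hy =>
          obtain ⟨i, rfl⟩ := hy
          rw [mul_comm]
          exact hxM i a ha'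
        | zero => rw [mul_zero, map_zero]; exact zero_mem _
        | add y z _ _ hy hz => rw [mul_add, map_add]; exact add_mem hy hz
        | smul c y _ hy =>
          have : Ideal.Quotient.mk I (a * c • y) = c • Ideal.Quotient.mk I (a * y) := by
            rw [mul_smul_comm]; rfl
          rw [this]
          exact M.smul_of_tower_mem c hy
  have htop : M = ⊤ := by
    rw [eq_top_iff]
    rintro z -
    obtain ⟨b, rfl⟩ := Ideal.Quotient.mk_surjective z
    induction b using DirectSum.Decomposition.inductionOn 𝒜 with
    | zero => rw [map_zero]; exact zero_mem _
    | homogeneous y => exact key _ _ y.2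
    | add y z hy hz => rw [map_add]; exact add_mem hy hz
  exact Module.finite_def.mpr ⟨hGf.toFinset, by rw [Set.Finite.coe_toFinset, ← hM, htop]⟩

end Graded

/-! ### Zariski openness of a spanning condition -/

section Openness

variable {k V B : Type*} [Field k] [AddCommGroup V] [Module k V] [CommRing B] [Algebra k B]

variable (k) in
/-- Maps from a vector space to a `k`-algebra given by a polynomial in linear forms with
coefficients in the algebra. -/
def IsPolynomialMap (F : V → B) : Prop :=
  ∃ f : MvPolynomial (Module.Dual k V) B,
    ∀ v, F v = MvPolynomial.eval (fun φ : Module.Dual k V => algebraMap k B (φ v)) f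

namespace IsPolynomialMap

theorem const (b : B) : IsPolynomialMap k (fun _ : V => b) :=
  ⟨MvPolynomial.C b, fun v => by simp⟩

theorem mul {F G : V → B} (hF : IsPolynomialMap k F) (hG : IsPolynomialMap k G) :
    IsPolynomialMap k (fun v => F v * G v) := by
  obtain ⟨f, hf⟩ := hF
  obtain ⟨g, hg⟩ := hG
  exact ⟨f * g, fun v => by simp only [hf, hg, map_mul]⟩

theorem prod {ι : Type*} (s : Finset ι) {F : ι → V → B} (hF : ∀ i, IsPolynomialMap k (F i)) :
    IsPolynomialMap k (fun v => ∏ i ∈ s, F i v) := by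
  choose f hf using hF
  exact ⟨∏ i ∈ s, f i, fun v => by
    rw [map_prod]
    exact Finset.prod_congr rfl fun i _ => hf i v⟩

theorem linear [Module.Finite k V] (L : V →ₗ[k] B) : IsPolynomialMap k L := by
  let b := Module.finBasis k V
  refine ⟨∑ i, MvPolynomial.X (b.coord i) * MvPolynomial.C (L (b i)), fun v => ?_⟩
  conv_lhs => rw [← b.sum_repr v, map_sum]
  rw [map_sum]
  refine Finset.sum_congr rfl fun i _ => ?_
  simp [Algebra.smul_def]

/-- On a monomial the values φ v are scalars, so l only acts on the coefficient. -/
theorem exists_polyEval {F : V → B} (hF : IsPolynomialMap k F) (l : B →ₗ[k] k) :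
    ∃ g : MvPolynomial (Module.Dual k V) k, ∀ v, l (F v) = polyEval g v := by
  obtain ⟨f, hf⟩ := hF
  suffices h : ∃ g : MvPolynomial (Module.Dual k V) k, ∀ v,
      l (MvPolynomial.eval (fun φ : Module.Dual k V => algebraMap k B (φ v)) f) =
        polyEval g v by
    obtain ⟨g, hg⟩ := h
    exact ⟨g, fun v => by rw [hf, hg]⟩
  clear hf
  induction f using MvPolynomial.induction_on' with
  | monomial u a =>
    refine ⟨MvPolynomial.monomial u (l a), fun v => ?_⟩
    rw [polyEval, MvPolynomial.eval_monomial, MvPolynomial.eval_monomial]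
    have : (u.prod fun φ e => algebraMap k B (φ v) ^ e) =
        algebraMap k B (u.prod fun φ e => φ v ^ e) := by
      rw [Finsupp.prod, Finsupp.prod, map_prod]
      exact Finset.prod_congr rfl fun φ _ => (map_pow _ _ _).symm
    rw [this, mul_comm, ← Algebra.smul_def, map_smul, smul_eq_mul, mul_comm]
  | add p q hp hq =>
    obtain ⟨g, hg⟩ := hp
    obtain ⟨h, hh⟩ := hq
    exact ⟨g + h, fun v => by rw [map_add, map_add, hg, hh, polyEval, polyEval, polyEval, map_add]⟩

end IsPolynomialMap

/-- Spanning a fixed finite dimensional space is an open condition. -/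
theorem exists_isZariskiOpen_span {ι : Type*} {e : ι → V → B} (he : ∀ i, IsPolynomialMap k (e i))
    (W : Submodule k B) [Module.Finite k W] (hW : ∀ i v, e i v ∈ W) {v₀ : V}
    (h₀ : W ≤ Submodule.span k (Set.range fun i => e i v₀)) :
    ∃ U : Set V, IsZariskiOpen k U ∧ v₀ ∈ U ∧
      ∀ v ∈ U, W ≤ Submodule.span k (Set.range fun i => e i v) := by
  classical
  let e' : ι → V → W := fun i v => ⟨e i v, hW i v⟩
  have hmap : ∀ v, (Submodule.span k (Set.range fun i => e' i v)).map W.subtype =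
      Submodule.span k (Set.range fun i => e i v) := by
    intro v
    rw [Submodule.map_span, ← Set.range_comp]
    rfl
  have htop : ∀ v, W ≤ Submodule.span k (Set.range fun i => e i v) ↔
      Submodule.span k (Set.range fun i => e' i v) = ⊤ := by
    intro v
    rw [← hmap v]
    constructor
    · intro h
      rw [eq_top_iff]
      rintro w -
      obtain ⟨w', hw', hww⟩ := h w.2
      have : w' = w := Subtype.ext hww
      exact this ▸ hw'
    · intro h w hw
      exact ⟨⟨w, hw⟩, by rw [h]; trivial, rfl⟩
  -- Select a basis of W among the vectors at v₀. The determinant in this basis of the same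
  -- selection at v is polynomial in v, equals 1 at v₀, and where nonzero it forces spanning.
  obtain ⟨κ, a, -, hspan, hli⟩ := exists_linearIndependent' k (fun i => e' i v₀)
  have hs : ⊤ ≤ Submodule.span k (Set.range ((fun i => e' i v₀) ∘ a)) := by
    rw [hspan, (htop v₀).mp h₀]
  let b := Module.Basis.mk hli hs
  have : Finite κ := Module.Finite.finite_basis b
  have := Fintype.ofFinite κ
  -- The coordinates live on W only; they are extended to B, where the maps are known to be
  -- polynomial.
  have hext : ∀ i, ∃ l : B →ₗ[k] k, l ∘ₗ W.subtype = b.coord i :=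
    fun i => LinearMap.exists_extend _
  choose l hl using hext
  have hg : ∀ i j, ∃ g : MvPolynomial (Module.Dual k V) k, ∀ v, l i (e (a j) v) = polyEval g v :=
    fun i j => (he (a j)).exists_polyEval (l i)
  choose g hg using hg
  have hdet : ∀ v, polyEval (Matrix.det (Matrix.of g)) v = b.det (fun j => e' (a j) v) := by
    intro v
    rw [polyEval, RingHom.map_det, Module.Basis.det_apply]
    congr 1
    ext i j
    rw [RingHom.mapMatrix_apply, Matrix.map_apply, Matrix.of_apply, Module.Basis.toMatrix_apply]
    have h1 := hg i j v
    rw [polyEval] at h1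
    rw [← h1]
    exact LinearMap.congr_fun (hl i) (e' (a j) v)
  refine ⟨{v | polyEval (Matrix.det (Matrix.of g)) v ≠ 0}, ⟨{Matrix.det (Matrix.of g)}, ?_⟩, ?_, ?_⟩
  · ext v
    simp
  · have hb : (fun j => e' (a j) v₀) = b := by
      ext j
      simp [b]
    rw [Set.mem_ofPred_eq, hdet, hb, Module.Basis.det_self]
    exact one_ne_zero
  · intro v hv
    rw [Set.mem_ofPred_eq, hdet] at hv
    have := ((Module.Basis.is_basis_iff_det b).mpr (isUnit_iff_ne_zero.mpr hv)).2
    rw [htop, eq_top_iff, ← this]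
    refine Submodule.span_mono ?_
    rintro _ ⟨j, rfl⟩
    exact ⟨a j, rfl⟩

/-- The point is the index set on the right, which does not depend on v: the determinant criterion
needs one fixed family of vectors varying with v. -/
theorem mul_sup_pow_eq_span {m : Type*} (p q : m → Prop) (v : m → B) (A : Submodule k B) (n : ℕ) :
    Submodule.span k {b | ∃ i, p i ∧ b = v i} * A ⊔ Submodule.span k {b | ∃ i, q i ∧ b = v i} ^ n =
      Submodule.span k (Set.range (Sum.elim (fun t : {i // p i} × A => v t.1 * t.2)
        (fun g : Fin n → {i // q i} => ∏ t, v (g t)))) := by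
  rw [Set.Sum.elim_range, Submodule.span_union]
  congr 1
  · conv_lhs => rw [← Submodule.span_eq A, Submodule.span_mul_span]
    congr 1
    ext b
    constructor
    · rintro ⟨_, ⟨i, hi, rfl⟩, a, ha, rfl⟩
      exact ⟨⟨⟨i, hi⟩, ⟨a, ha⟩⟩, rfl⟩
    · rintro ⟨⟨⟨i, hi⟩, ⟨a, ha⟩⟩, rfl⟩
      exact ⟨_, ⟨i, hi, rfl⟩, a, ha, rfl⟩
  · rw [Submodule.span_pow]
    congr 1
    ext b
    rw [Set.mem_pow]
    constructor
    · rintro ⟨f, rfl⟩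
      choose g hg using fun t => (f t).2
      refine ⟨fun t => ⟨g t, (hg t).1⟩, ?_⟩
      rw [List.prod_ofFn]
      exact Finset.prod_congr rfl fun t _ => ((hg t).2).symm
    · rintro ⟨g, rfl⟩
      refine ⟨fun t => ⟨v (g t), (g t).1, (g t).2, rfl⟩, ?_⟩
      rw [List.prod_ofFn]

end Openness

/-- The reduction condition in a given degree is Zariski open in the tuple of linear forms. -/
theorem IsStandardGraded.exists_isZariskiOpen {k B : Type*} [Field k] [CommRing B] [Algebra k B]
    {𝒜 : ℕ → Submodule k B} [GradedAlgebra 𝒜] (hB : IsStandardGraded 𝒜) {m : ℕ}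
    (p q : Fin m → Prop) (n : ℕ) {v₀ : Fin m → 𝒜 1}
    (h₀ : 𝒜 (n + 1) ≤ Submodule.span k {b : B | ∃ i, p i ∧ b = v₀ i} * 𝒜 n ⊔
      Submodule.span k {b : B | ∃ i, q i ∧ b = v₀ i} ^ (n + 1)) :
    ∃ U : Set (Fin m → 𝒜 1), IsZariskiOpen k U ∧ v₀ ∈ U ∧ ∀ v ∈ U,
      𝒜 (n + 1) ≤ Submodule.span k {b : B | ∃ i, p i ∧ b = v i} * 𝒜 n ⊔
        Submodule.span k {b : B | ∃ i, q i ∧ b = v i} ^ (n + 1) := by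
  have := hB.degree_one_finite
  have := hB.finite_graded (n + 1)
  have key := fun v : Fin m → 𝒜 1 => mul_sup_pow_eq_span p q (fun i => (v i : B)) (𝒜 n) (n + 1)
  simp only [key] at h₀ ⊢
  let e : ({i // p i} × 𝒜 n) ⊕ (Fin (n + 1) → {i // q i}) → (Fin m → 𝒜 1) → B :=
    fun t v => Sum.elim (fun t : {i // p i} × 𝒜 n => (v t.1 : B) * t.2)
        (fun g : Fin (n + 1) → {i // q i} => ∏ t, (v (g t) : B)) t
  have hlin : ∀ i : Fin m, IsPolynomialMap k (fun v : Fin m → 𝒜 1 => (v i : B)) := fun i =>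
    IsPolynomialMap.linear
      ((𝒜 1).subtype ∘ₗ (LinearMap.proj i : (Fin m → 𝒜 1) →ₗ[k] 𝒜 1))
  refine exists_isZariskiOpen_span (e := e) ?_ (𝒜 (n + 1)) ?_ h₀
  · rintro (⟨i, b⟩ | g)
    · exact (hlin i).mul (IsPolynomialMap.const (b : B))
    · exact IsPolynomialMap.prod Finset.univ fun t => hlin (g t)
  · rintro (⟨i, b⟩ | g) v
    · have := SetLike.mul_mem_graded (v i).2 b.2
      rwa [add_comm 1 n] at this
    · have := SetLike.prod_mem_graded 𝒜 (fun _ => 1) (fun t => (v (g t) : B))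
        (F := Finset.univ) fun t _ => (v (g t)).2
      simp only [Finset.sum_const, Finset.card_univ, Fintype.card_fin, smul_eq_mul, mul_one] at this
      exact this

/-! ### Krull dimension: integral extensions, quotients and heights -/

section Dimension

variable {R S : Type*} [CommRing R] [CommRing S]

/-- Incomparability: contraction of primes is strictly monotone. -/
theorem ringKrullDim_le_of_isIntegral (f : R →+* S) (hf : f.IsIntegral) :
    ringKrullDim S ≤ ringKrullDim R := by
  let := f.toAlgebra
  have : Algebra.IsIntegral R S := ⟨hf⟩
  refine Order.krullDim_le_of_strictMono (PrimeSpectrum.comap f) fun p q hpq => ?_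
  exact Ideal.IsIntegral.comap_lt_comap (A := S) (R := R) hpq

/-- Lying over for the smallest prime of a chain, then going up for the rest. -/
theorem le_ringKrullDim_of_injective_of_isIntegral (f : R →+* S) (hf : f.IsIntegral)
    (hinj : Function.Injective f) : ringKrullDim R ≤ ringKrullDim S := by
  let := f.toAlgebra
  have : Algebra.IsIntegral R S := ⟨hf⟩
  refine iSup_le fun l => ?_
  obtain ⟨Q, -, hp, hQ⟩ := Ideal.exists_ideal_over_prime_of_isIntegral l.head.asIdeal (⊥ : Ideal S)
    (by
      intro x hx
      have : f x = 0 := hx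
      rw [(injective_iff_map_eq_zero f).mp hinj x this]
      exact zero_mem _)
  have : Q.LiesOver l.head.asIdeal := ⟨hQ.symm⟩
  obtain ⟨L, hL, -⟩ := Ideal.exists_ltSeries_of_hasGoingUp l Q
  rw [← hL]
  exact Order.LTSeries.length_le_krullDim L

theorem ringKrullDim_quotient_succ_le_of_lt {p q : Ideal R} [p.IsPrime] (h : p < q) :
    ringKrullDim (R ⧸ q) + 1 ≤ ringKrullDim (R ⧸ p) := by
  obtain ⟨x, hxq, hxp⟩ := Set.exists_of_ssubset h
  refine ringKrullDim_succ_le_of_surjective (Ideal.Quotient.factor h.le)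
    (Ideal.Quotient.factor_surjective h.le) (r := Ideal.Quotient.mk p x) ?_ ?_
  · refine mem_nonZeroDivisors_of_ne_zero ?_
    rwa [Ne, Ideal.Quotient.eq_zero_iff_mem]
  · rw [Ideal.Quotient.factor_mk, Ideal.Quotient.eq_zero_iff_mem]
    exact hxq

theorem Ideal.height_add_ringKrullDim_quotient_le (p : Ideal R) [hp : p.IsPrime] :
    (p.height : WithBot ℕ∞) + ringKrullDim (R ⧸ p) ≤ ringKrullDim R := by
  let P : PrimeSpectrum R := ⟨p, hp⟩
  have : Nonempty (PrimeSpectrum R) := ⟨P⟩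
  have h1 : ringKrullDim (R ⧸ p) = (Order.coheight P : WithBot ℕ∞) := by
    rw [ringKrullDim_quotient, Order.coheight_eq_krullDim_Ici]
    rfl
  have h2 : p.height = Order.height P := PrimeSpectrum.height_eq_orderHeight P
  rw [h1, h2, ringKrullDim, Order.krullDim_eq_iSup_height_add_coheight_of_nonempty]
  rw [← WithBot.coe_add, WithBot.coe_le_coe]
  exact le_iSup (fun a : PrimeSpectrum R => Order.height a + Order.coheight a) P

end Dimension

/-! ### Finiteness over a polynomial ring in linear forms -/

section Graded

variable {k B : Type*} [Field k] [CommRing B] [Algebra k B]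
variable {𝒜 : ℕ → Submodule k B} [GradedAlgebra 𝒜]

theorem IsStandardGraded.finite_quotient (hB : IsStandardGraded 𝒜) {ι : Type*} {x : ι → B}
    (hx : ∀ i, x i ∈ 𝒜 1) {I : Ideal B} (hI : I.IsHomogeneous 𝒜)
    (hm : (HomogeneousIdeal.irrelevant 𝒜).toIdeal ≤ (Ideal.span (Set.range x) ⊔ I).radical) :
    ((Ideal.Quotient.mkₐ k I).comp (MvPolynomial.aeval x)).toRingHom.Finite := by
  have := hB.isNoetherianRing
  obtain ⟨N, hN⟩ := Ideal.exists_pow_le_of_le_radical_of_fg hm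
    ((isNoetherianRing_iff_ideal_fg B).mp inferInstance _)
  refine hB.exists_fg_span hx hI (N := N) ?_
  rw [hB.irrelevant_pow] at hN
  exact Ideal.subset_span.trans hN

theorem IsStandardGraded.finite_aeval (hB : IsStandardGraded 𝒜) {ι : Type*} {x : ι → B}
    (hx : ∀ i, x i ∈ 𝒜 1)
    (hm : (HomogeneousIdeal.irrelevant 𝒜).toIdeal ≤ (Ideal.span (Set.range x)).radical) :
    (MvPolynomial.aeval x : MvPolynomial ι k →ₐ[k] B).toRingHom.Finite := by
  have h := hB.finite_quotient hx (I := ⊥) (Ideal.IsHomogeneous.bot 𝒜) (by rwa [sup_bot_eq])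
  have h2 := (RingHom.Finite.of_surjective (RingEquiv.quotientBot B).toRingHom
    (RingEquiv.quotientBot B).surjective).comp h
  exact h2

theorem IsStandardGraded.ringKrullDim_quotient_le (hB : IsStandardGraded 𝒜) {ι : Type*} [Fintype ι]
    {x : ι → B} (hx : ∀ i, x i ∈ 𝒜 1) {I : Ideal B} (hI : I.IsHomogeneous 𝒜)
    (hm : (HomogeneousIdeal.irrelevant 𝒜).toIdeal ≤ (Ideal.span (Set.range x) ⊔ I).radical) :
    ringKrullDim (B ⧸ I) ≤ Fintype.card ι := by
  refine (ringKrullDim_le_of_isIntegral _ (hB.finite_quotient hx hI hm).to_isIntegral).trans ?_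
  rw [MvPolynomial.ringKrullDim_of_isNoetherianRing, ringKrullDim_eq_zero_of_field, zero_add,
    Nat.card_eq_fintype_card]

end Graded

/-! ### Necessity of the bound on the embedding dimension -/

section Necessity

variable {k B : Type*} [Field k] [CommRing B] [Algebra k B]
variable {𝒜 : ℕ → Submodule k B} [GradedAlgebra 𝒜]

/-- Otherwise 𝔪 lies in the radical of (x) + q, and B/q is finite over a polynomial ring in too few
variables. -/
theorem IsStandardGraded.exists_prime_ge (hB : IsStandardGraded 𝒜) {ι : Type*} [Fintype ι]
    {x : ι → B} (hx : ∀ i, x i ∈ 𝒜 1) {q : Ideal B} (hq : q.IsHomogeneous 𝒜)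
    (hd : (Fintype.card ι : WithBot ℕ∞) < ringKrullDim (B ⧸ q)) :
    ∃ P : Ideal B, P.IsPrime ∧ q ≤ P ∧ (∀ i, x i ∈ P) ∧
      ¬ (HomogeneousIdeal.irrelevant 𝒜).toIdeal ≤ P := by
  by_contra hcon
  push Not at hcon
  refine absurd (hB.ringKrullDim_quotient_le hx hq ?_) (not_le.mpr hd)
  rw [Ideal.radical_eq_sInf]
  refine le_sInf fun P hP => ?_
  refine hcon P hP.2 (le_sup_right.trans hP.1) fun i => ?_
  exact hP.1 (Ideal.mem_sup_left (Ideal.subset_span ⟨i, rfl⟩))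

/-- The maximal ideal of the localization at `q` is generated by at most `height (φ⁻¹ q)` elements
if the finite map `φ` becomes surjective after inverting an element outside `φ⁻¹ q`. -/
theorem embeddingDimension_le_of_smul_mem_range {C : Type*} [CommRing C] [IsRegularRing C]
    [IsNoetherianRing B] (φ : C →+* B) (q : Ideal B) [q.IsPrime] {c : C} (hc : φ c ∉ q)
    (hcB : ∀ b, ∃ c', φ c' = φ c * b) {s : ℕ} (hs : (q.comap φ).height ≤ s) :
    embeddingDimension (Localization.AtPrime q) ≤ s := by
  set p := q.comap φ with hp
  have : p.IsPrime := Ideal.comap_isPrime φ q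
  let ψ := Localization.localRingHom p q φ hp
  have hψ : ∀ a, ψ (algebraMap C (Localization.AtPrime p) a) =
      algebraMap B (Localization.AtPrime q) (φ a) := Localization.localRingHom_to_map p q φ hp
  have hreg : IsRegularLocalRing (Localization.AtPrime p) :=
    IsRegularRing.isRegularLocalRing_localization p
  have hrank : (IsLocalRing.maximalIdeal (Localization.AtPrime p)).spanFinrank ≤ s := by
    have h1 := hreg.spanFinrank_maximalIdeal
    rw [IsLocalization.AtPrime.ringKrullDim_eq_height p] at h1
    have h2 : ((p.height : ℕ∞) : WithBot ℕ∞) ≤ ((s : ℕ∞) : WithBot ℕ∞) := by exact_mod_cast hs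
    rw [← h1] at h2
    exact_mod_cast h2
  have hfg : (IsLocalRing.maximalIdeal (Localization.AtPrime p)).FG :=
    (isNoetherianRing_iff_ideal_fg _).mp inferInstance _
  obtain ⟨G, hGcard, hGspan⟩ := Submodule.FG.exists_span_finset_card_eq_spanFinrank hfg
  have hmax : IsLocalRing.maximalIdeal (Localization.AtPrime q) =
      Ideal.span (ψ '' G) := by
    apply le_antisymm
    · rw [← Localization.AtPrime.map_eq_maximalIdeal, Ideal.map_le_iff_le_comap]
      intro b hb
      rw [Ideal.mem_comap]
      -- The multiple φ(c) b comes from some c' in p, and φ(c) is a unit in the localization at q,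
      -- so b itself lies in the ideal generated by the images of G.
      obtain ⟨c', hc'⟩ := hcB b
      have hc'p : c' ∈ p := by
        rw [hp, Ideal.mem_comap, hc']
        exact q.mul_mem_left _ hb
      have h1 : algebraMap C (Localization.AtPrime p) c' ∈
          Ideal.span (G : Set (Localization.AtPrime p)) := by
        have : Ideal.span (G : Set (Localization.AtPrime p)) =
          IsLocalRing.maximalIdeal (Localization.AtPrime p) := hGspan
        rw [this, ← Localization.AtPrime.map_eq_maximalIdeal]
        exact Ideal.mem_map_of_mem _ hc'p
      have h2 := Ideal.mem_map_of_mem ψ h1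
      rw [Ideal.map_span, hψ, hc', map_mul] at h2
      have hu : IsUnit (algebraMap B (Localization.AtPrime q) (φ c)) :=
        IsLocalization.map_units (M := q.primeCompl) _ ⟨φ c, hc⟩
      exact (Ideal.unit_mul_mem_iff_mem _ hu).mp h2
    · rw [Ideal.span_le]
      rintro _ ⟨g, hg, rfl⟩
      have hg' : g ∈ IsLocalRing.maximalIdeal (Localization.AtPrime p) := by
        rw [← hGspan]
        exact Submodule.subset_span hg
      have : IsLocalHom ψ := Localization.isLocalHom_localRingHom p q φ hp
      rw [SetLike.mem_coe, IsLocalRing.mem_maximalIdeal] at *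
      exact map_mem_nonunits_iff ψ g |>.mpr hg'
  have hnoeth : IsNoetherianRing (Localization.AtPrime q) :=
    IsLocalization.isNoetherianRing q.primeCompl _ inferInstance
  rw [embeddingDimension, ← IsLocalRing.spanFinrank_maximalIdeal_eq_finrank_cotangentSpace, hmax]
  refine (Submodule.spanFinrank_span_le_ncard_of_finite (G.finite_toSet.image ψ)).trans ?_
  refine (Set.ncard_image_le G.finite_toSet).trans ?_
  rw [Set.ncard_coe_finset, hGcard]
  exact hrank

/-- A determinant trick: if a power of `a` multiplies `B` into `J B + im φ`, then some element
congruent to a power of `a` modulo `J` multiplies `B` into the image of `φ`. -/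
theorem exists_smul_mem_range {C : Type*} [CommRing C] (φ : C →+* B) (hφ : φ.Finite) (J : Ideal C)
    (a : C) (ha : ∀ b, ∃ b' ∈ J.map φ, ∃ c', φ a * b = b' + φ c') (P : Ideal C) [P.IsPrime]
    (hJP : J ≤ P) (haP : a ∉ P) : ∃ c ∉ P, ∀ b, ∃ c', φ c' = φ c * b := by
  let := φ.toAlgebra
  have hfin : Module.Finite C B := hφ
  -- Cayley–Hamilton is applied to multiplication by a on B modulo the image of φ: it maps that
  -- module into J times itself, so f(a) kills it for a monic f with lower coefficients in J.
  let N : Submodule C B := LinearMap.range (Algebra.linearMap C B)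
  have hrange : LinearMap.range (algebraMap C (Module.End C (B ⧸ N)) a) ≤ J • ⊤ := by
    rintro _ ⟨m, rfl⟩
    obtain ⟨b, rfl⟩ := Submodule.mkQ_surjective N m
    rw [Module.algebraMap_end_apply, ← map_smul]
    obtain ⟨b', hb', c', hc'⟩ := ha b
    have h1 : a • b = b' + φ c' := by rw [← hc']; rfl
    have h2 : N.mkQ (φ c') = 0 := by
      rw [Submodule.mkQ_apply, Submodule.Quotient.mk_eq_zero]
      exact ⟨c', rfl⟩
    rw [h1, map_add, h2, add_zero]
    have h3 : b' ∈ J • (⊤ : Submodule C B) := by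
      rw [Ideal.smul_top_eq_map]
      exact hb'
    have h4 := Submodule.mem_map_of_mem (f := N.mkQ) h3
    rw [Submodule.map_smul''] at h4
    exact Submodule.smul_mono le_rfl le_top h4
  obtain ⟨f, hmonic, -, hcoeff, heval⟩ :=
    LinearMap.exists_monic_and_natDegree_eq_and_coeff_mem_pow_and_aeval_eq_zero C _ J hrange
  refine ⟨f.eval a, ?_, fun b => ?_⟩
  · intro hmem
    rw [Polynomial.eval_eq_sum_range, Finset.sum_range_succ, hmonic.coeff_natDegree, one_mul] at hmem
    have hsum : ∑ i ∈ Finset.range f.natDegree, f.coeff i * a ^ i ∈ P := by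
      refine sum_mem fun i hi => P.mul_mem_right _ (hJP ?_)
      refine Ideal.pow_le_self ?_ (hcoeff i)
      rw [Finset.mem_range] at hi
      omega
    exact haP (Ideal.IsPrime.mem_of_pow_mem inferInstance _ ((Ideal.add_mem_iff_right P hsum).mp hmem))
  · rw [Polynomial.aeval_algebraMap_apply] at heval
    have h := LinearMap.congr_fun heval (N.mkQ b)
    rw [Module.algebraMap_end_apply, LinearMap.zero_apply, ← map_smul, Submodule.mkQ_apply,
      Submodule.Quotient.mk_eq_zero] at h
    obtain ⟨c', hc'⟩ := h
    exact ⟨c', hc'.trans (Algebra.smul_def _ _)⟩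

theorem IsStandardGraded.embeddingDimension_le (hB : IsStandardGraded 𝒜) {d s : ℕ} (hd : 1 ≤ d)
    {x : Fin (d + s) → B} (hx : ∀ i, x i ∈ 𝒜 1) {n : ℕ}
    (hn : ∀ m ≥ n, 𝒜 (m + 1) ≤
      Submodule.span k {b : B | ∃ i : Fin (d + s), (i : ℕ) + 1 < d ∧ b = x i} * 𝒜 m ⊔
        Submodule.span k {b : B | ∃ i : Fin (d + s), d ≤ (i : ℕ) + 1 ∧ b = x i} ^ (m + 1))
    (q : Ideal B) [q.IsPrime] (hq : q ∈ minimalPrimes B) (hdim : ringKrullDim (B ⧸ q) = d) :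
    embeddingDimension (Localization.AtPrime q) ≤ s := by
  have hnoeth := hB.isNoetherianRing
  have hqh : q.IsHomogeneous 𝒜 :=
    isHomogeneous_of_mem_minimalPrimes (Ideal.IsHomogeneous.bot 𝒜) hq
  let φ : MvPolynomial (Fin (d + s)) k →+* B :=
    (MvPolynomial.aeval x : MvPolynomial (Fin (d + s)) k →ₐ[k] B).toRingHom
  have hφX : ∀ i, φ (MvPolynomial.X i) = x i := fun i => MvPolynomial.aeval_X x i
  have hJY : ∀ p : Fin (d + s) → Prop, Ideal.span {b : B | ∃ i, p i ∧ b = x i} ≤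
      Ideal.span (Set.range x) := fun p =>
    Ideal.span_mono (by rintro _ ⟨i, -, rfl⟩; exact ⟨i, rfl⟩)
  have hm : (HomogeneousIdeal.irrelevant 𝒜).toIdeal ≤ (Ideal.span (Set.range x)).radical := by
    refine fun b hb => ⟨n + 1, ?_⟩
    have h1 := Ideal.pow_mem_pow hb (n + 1)
    rw [hB.irrelevant_pow] at h1
    have h2 : b ^ (n + 1) ∈ Ideal.span ((Submodule.span k
        {b : B | ∃ i : Fin (d + s), (i : ℕ) + 1 < d ∧ b = x i} * 𝒜 n ⊔ Submodule.span k
        {b : B | ∃ i : Fin (d + s), d ≤ (i : ℕ) + 1 ∧ b = x i} ^ (n + 1) : Submodule k B) : Set B) :=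
      Ideal.span_mono (SetLike.coe_subset_coe.mpr (hn n le_rfl)) h1
    rw [ideal_span_sup, ideal_span_mul, ideal_span_pow, ideal_span_submodule_span,
      ideal_span_submodule_span] at h2
    refine (sup_le ?_ ?_ : _ ≤ Ideal.span (Set.range x)) h2
    · exact Ideal.mul_le_left.trans (hJY fun i => (i : ℕ) + 1 < d)
    · exact (Ideal.pow_le_self (Nat.succ_ne_zero n)).trans (hJY fun i => d ≤ (i : ℕ) + 1)
  have hφ : φ.Finite := hB.finite_aeval hx hm
  -- The d - 1 forms in J are too few to cut the d-dimensional ring B/q down to its irrelevant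
  -- ideal.
  obtain ⟨P, hP, hqP, hxP, hmP⟩ := hB.exists_prime_ge
    (x := fun i : {i : Fin (d + s) // (i : ℕ) + 1 < d} => x i) (fun i => hx i) hqh (by
      rw [hdim]
      have hcard : Fintype.card {i : Fin (d + s) // (i : ℕ) + 1 < d} ≤ d - 1 := by
        have hinj : Function.Injective
            (fun i : {i : Fin (d + s) // (i : ℕ) + 1 < d} => (⟨i.1, by omega⟩ : Fin (d - 1))) := by
          intro i j hij
          exact Subtype.ext (Fin.ext (by simpa using hij))
        simpa using Fintype.card_le_of_injective _ hinj
      exact_mod_cast (by omega : Fintype.card {i : Fin (d + s) // (i : ℕ) + 1 < d} < d))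
  obtain ⟨j, hj⟩ : ∃ j, x j ∉ P := by
    by_contra! hcon
    refine hmP (hm.trans ?_)
    rw [← hP.radical]
    refine Ideal.radical_mono (Ideal.span_le.mpr ?_)
    rintro _ ⟨i, rfl⟩
    exact hcon i
  let J : Ideal (MvPolynomial (Fin (d + s)) k) :=
    Ideal.span {f | ∃ i : Fin (d + s), (i : ℕ) + 1 < d ∧ f = MvPolynomial.X i}
  have hJmap : J.map φ = Ideal.span {b : B | ∃ i : Fin (d + s), (i : ℕ) + 1 < d ∧ b = x i} := by
    rw [Ideal.map_span]
    congr 1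
    ext b
    constructor
    · rintro ⟨_, ⟨i, hi, rfl⟩, rfl⟩
      exact ⟨i, hi, hφX i⟩
    · rintro ⟨i, hi, rfl⟩
      exact ⟨_, ⟨i, hi, rfl⟩, hφX i⟩
  have hYrange : ∀ m, ∀ b ∈ Submodule.span k
      {b : B | ∃ i : Fin (d + s), d ≤ (i : ℕ) + 1 ∧ b = x i} ^ m, ∃ c, φ c = b := by
    intro m b hb
    have h1 := pow_le_adjoin _ m hb
    rw [Subalgebra.mem_toSubmodule, Algebra.adjoin_span] at h1
    have h2 := Algebra.adjoin_mono (t := Set.range x)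
      (by rintro _ ⟨i, -, rfl⟩; exact ⟨i, rfl⟩) h1
    rw [Algebra.adjoin_range_eq_range_aeval] at h2
    exact h2
  -- The exponent n + 1 lifts homogeneous elements of every degree into the range of `hn`. There the
  -- first summand lies in JB and the second in the image of φ.
  obtain ⟨c, hcP, hc⟩ := exists_smul_mem_range φ hφ J (MvPolynomial.X j ^ (n + 1)) (by
      intro b
      rw [hJmap]
      induction b using DirectSum.Decomposition.inductionOn 𝒜 with
      | zero => exact ⟨0, zero_mem _, 0, by simp⟩
      | @homogeneous i b =>
        have h1 : φ (MvPolynomial.X j ^ (n + 1)) * (b : B) ∈ 𝒜 (n + i + 1) := by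
          rw [map_pow, hφX]
          have := SetLike.mul_mem_graded (SetLike.pow_mem_graded (n + 1) (hx j)) b.2
          convert this using 2
          simp
          omega
        obtain ⟨u, hu, v, hv, huv⟩ := Submodule.mem_sup.mp (hn (n + i) (by omega) h1)
        obtain ⟨c', rfl⟩ := hYrange _ v hv
        refine ⟨u, ?_, c', huv.symm⟩
        have : u ∈ Ideal.span ((Submodule.span k {b : B | ∃ i : Fin (d + s),
          (i : ℕ) + 1 < d ∧ b = x i} * 𝒜 (n + i) : Submodule k B) : Set B) := Ideal.subset_span hu
        rw [ideal_span_mul, ideal_span_submodule_span] at this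
        exact Ideal.mul_le_left this
      | add y z hy hz =>
        obtain ⟨u, hu, c, hc⟩ := hy
        obtain ⟨u', hu', c', hc'⟩ := hz
        refine ⟨u + u', add_mem hu hu', c + c', ?_⟩
        rw [mul_add, hc, hc', map_add]
        ring) (P.comap φ) (by
      rw [Ideal.span_le]
      rintro _ ⟨i, hi, rfl⟩
      rw [SetLike.mem_coe, Ideal.mem_comap, hφX]
      exact hxP ⟨i, hi⟩) (by
      rw [Ideal.mem_comap, map_pow, hφX]
      exact fun h => hj (hP.mem_of_pow_mem _ h))
  refine embeddingDimension_le_of_smul_mem_range φ q (c := c) (fun h => hcP (hqP h)) hc ?_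
  -- B/q is integral over C/p with p = q ∩ C, so d ≤ dim C/p; with ht p + dim C/p ≤ d + s this gives
  -- ht p ≤ s.
  have hint : ((Ideal.quotientMap q φ le_rfl) :
      MvPolynomial (Fin (d + s)) k ⧸ q.comap φ →+* B ⧸ q).IsIntegral := by
    refine RingHom.IsIntegral.tower_top (Ideal.Quotient.mk (q.comap φ)) _ ?_
    rw [Ideal.quotientMap_comp_mk]
    exact RingHom.IsIntegral.trans _ _ hφ.to_isIntegral
      (RingHom.isIntegral_of_surjective _ Ideal.Quotient.mk_surjective)
  have h1 := ringKrullDim_le_of_isIntegral _ hint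
  have hprime : (q.comap φ).IsPrime := Ideal.comap_isPrime φ q
  have h2 := Ideal.height_add_ringKrullDim_quotient_le (q.comap φ)
  rw [MvPolynomial.ringKrullDim_of_isNoetherianRing, ringKrullDim_eq_zero_of_field, zero_add,
    Nat.card_eq_fintype_card, Fintype.card_fin] at h2
  rw [hdim] at h1
  have h3 : ((q.comap φ).height : WithBot ℕ∞) + (d : WithBot ℕ∞) ≤ ((d + s : ℕ) : WithBot ℕ∞) :=
    (add_le_add_right h1 _).trans h2
  have h4 : (q.comap φ).height + (d : ℕ∞) ≤ ((d + s : ℕ) : ℕ∞) := by exact_mod_cast h3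
  rw [Nat.cast_add, add_comm (d : ℕ∞)] at h4
  exact (ENat.add_le_add_iff_right (ENat.natCast_ne_top d)).mp h4

end Necessity

/-! ### Generic generation from derivations and geometric points -/

section Unramified

open TensorProduct

/-- T/p is a field finite over K, hence embeds in Ω. -/
theorem exists_algHom_eq_zero_imp_mem {K T : Type*} [Field K] [CommRing T] [Algebra K T]
    [Module.Finite K T] (Ω : Type*) [Field Ω] [IsAlgClosed Ω] [Algebra K Ω] (p : Ideal T)
    [p.IsPrime] : ∃ π : T →ₐ[K] Ω, ∀ z, π z = 0 → z ∈ p := by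
  have : Algebra.IsIntegral K (T ⧸ p) := inferInstance
  let : Field (T ⧸ p) := (isField_of_isIntegral_of_isField' (Field.toIsField K)).toField
  let ρ : (T ⧸ p) →ₐ[K] Ω := IsAlgClosed.lift
  refine ⟨ρ.comp (Ideal.Quotient.mkₐ K p), fun z hz => ?_⟩
  rw [← Ideal.Quotient.eq_zero_iff_mem]
  exact ρ.toRingHom.injective (by rw [map_zero]; exact hz)

/-- A finite dimensional algebra which is unramified over a subalgebra, and whose geometric points
are determined by their restriction to the subalgebra, equals the subalgebra. -/
theorem Subalgebra.eq_top_of_unramified {K E : Type*} [Field K] [CommRing E] [Algebra K E]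
    [Module.Finite K E] (Ω : Type*) [Field Ω] [IsAlgClosed Ω] [Algebra K Ω] (S : Subalgebra K E)
    (hΩ : Subsingleton (Ω[E⁄S]))
    (hsep : ∀ φ ψ : E →ₐ[K] Ω, (∀ a ∈ S, φ a = ψ a) → φ = ψ) : S = ⊤ := by
  have : Module.Finite S E := Module.Finite.of_restrictScalars_finite K S E
  have hfin : Module.Finite K (E ⊗[S] E) := Module.Finite.trans (R := K) E (E ⊗[S] E)
  set I := KaehlerDifferential.ideal S E with hI
  -- Since Ω is I/I², its vanishing makes I idempotent. Each prime of E ⊗ E contains the kernel of a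
  -- map to the algebraically closed field, that is, of a pair of geometric points of E agreeing on
  -- S; such points coincide, so I lies in the prime. Idempotent and nilpotent, I is zero, so S → E
  -- is a finite epimorphism, hence surjective.
  have hid : IsIdempotentElem I := (Ideal.cotangent_subsingleton_iff I).mp hΩ
  have hnil : I ≤ nilradical (E ⊗[S] E) := by
    rw [nilradical_eq_sInf]
    refine le_sInf fun p hp => ?_
    have hp : p.IsPrime := hp
    obtain ⟨π, hker⟩ := exists_algHom_eq_zero_imp_mem (K := K) Ω p
    let φ : E →ₐ[K] Ω :=
      π.comp ((Algebra.TensorProduct.includeLeft : E →ₐ[S] E ⊗[S] E).restrictScalars K)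
    let ψ : E →ₐ[K] Ω :=
      π.comp ((Algebra.TensorProduct.includeRight : E →ₐ[S] E ⊗[S] E).restrictScalars K)
    have hφψ : φ = ψ := by
      refine hsep φ ψ fun a ha => ?_
      have : (a ⊗ₜ[S] (1 : E)) = (1 : E) ⊗ₜ[S] a := by
        have h := TensorProduct.smul_tmul (R := S) (⟨a, ha⟩ : S) (1 : E) (1 : E)
        simpa [Algebra.smul_def] using h
      change π (a ⊗ₜ[S] (1 : E)) = π ((1 : E) ⊗ₜ[S] a)
      rw [this]
    rw [hI, ← KaehlerDifferential.span_range_eq_ideal, Ideal.span_le]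
    rintro _ ⟨a, rfl⟩
    refine hker _ ?_
    have := AlgHom.congr_fun hφψ a
    rw [map_sub, sub_eq_zero]
    exact this.symm
  have hIbot : I = ⊥ := by
    have hnoeth : IsNoetherianRing (E ⊗[S] E) := IsNoetherianRing.of_finite K _
    obtain ⟨n, hn⟩ := (Ideal.FG.isNilpotent_iff_le_nilradical
      ((isNoetherianRing_iff_ideal_fg _).mp hnoeth I)).mpr hnil
    have h1 : I ^ (n + 1) = I := hid.pow_succ_eq n
    rw [← h1, pow_succ, hn, zero_mul, Ideal.zero_eq_bot]
  have hepi : Algebra.IsEpi S E := by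
    rw [Algebra.isEpi_iff_forall_one_tmul_eq]
    intro a
    have : (1 : E) ⊗ₜ[S] a - a ⊗ₜ[S] (1 : E) ∈ I := by
      rw [hI, ← KaehlerDifferential.span_range_eq_ideal]
      exact Ideal.subset_span ⟨a, rfl⟩
    rw [hIbot, Ideal.mem_bot, sub_eq_zero] at this
    exact this
  have hsurj := Algebra.isEpi_iff_surjective_algebraMap_of_finite.mp hepi
  rw [eq_top_iff]
  rintro a -
  obtain ⟨b, rfl⟩ := hsurj a
  exact b.2

/-- A finitely generated module of differentials vanishes if there are no nonzero derivations into
residue fields. -/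
theorem subsingleton_kaehlerDifferential {S E : Type*} [CommRing S] [CommRing E] [Algebra S E]
    [Module.Finite E (Ω[E⁄S])]
    (h : ∀ (M : Ideal E) [M.IsMaximal] (D : Derivation S E (E ⧸ M)), D = 0) :
    Subsingleton (Ω[E⁄S]) := by
  by_contra hne
  rw [not_subsingleton_iff_nontrivial] at hne
  -- A nonzero finitely generated module has a simple quotient, isomorphic to some E/M; composing it
  -- with the universal derivation gives a forbidden derivation.
  obtain ⟨N, hN, -⟩ := (eq_top_or_exists_le_coatom (⊥ : Submodule E (Ω[E⁄S]))).resolve_left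
    bot_ne_top
  have hsimple : IsSimpleModule E (Ω[E⁄S] ⧸ N) := isSimpleModule_iff_isCoatom.mpr hN
  obtain ⟨M, hM, ⟨e⟩⟩ := isSimpleModule_iff_quot_maximal.mp hsimple
  let f : Ω[E⁄S] →ₗ[E] E ⧸ M := e.toLinearMap ∘ₗ N.mkQ
  have hf : f.compDer (KaehlerDifferential.D S E) = 0 := h M _
  have hf0 : f = 0 := by
    refine LinearMap.ext_on_range (KaehlerDifferential.span_range_derivation S E) fun a => ?_
    exact Derivation.congr_fun hf a
  apply hN.1
  rw [eq_top_iff]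
  rintro w -
  have h1 : e (N.mkQ w) = 0 := LinearMap.congr_fun hf0 w
  rw [LinearEquiv.map_eq_zero_iff, Submodule.mkQ_apply, Submodule.Quotient.mk_eq_zero] at h1
  exact h1

universe u v

/-- A derivation on a base change which restricts to zero on the original algebra is zero. -/
theorem derivation_tensorProduct_eq_zero {P K B F : Type*} [CommRing P] [Field K] [Algebra P K]
    [CommRing B] [Algebra P B] (S : Subalgebra K (K ⊗[P] B)) [AddCommGroup F]
    [Module (K ⊗[P] B) F] [Module S F] [IsScalarTower S (K ⊗[P] B) F]
    (D : Derivation S (K ⊗[P] B) F) (hD : ∀ b : B, D ((1 : K) ⊗ₜ[P] b) = 0) : D = 0 := by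
  ext e
  rw [Derivation.zero_apply]
  induction e using TensorProduct.induction_on with
  | zero => rw [map_zero]
  | tmul c b =>
    have hc : c ⊗ₜ[P] b = (algebraMap S (K ⊗[P] B) (algebraMap K S c)) * ((1 : K) ⊗ₜ[P] b) := by
      change c ⊗ₜ[P] b = (c ⊗ₜ[P] (1 : B)) * ((1 : K) ⊗ₜ[P] b)
      rw [Algebra.TensorProduct.tmul_mul_tmul, mul_one, one_mul]
    rw [hc, Derivation.leibniz, hD b, Derivation.map_algebraMap, smul_zero, smul_zero, add_zero]
  | add a b ha hb => rw [map_add, ha, hb, add_zero]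

theorem exists_smul_eq_of_mem_adjoin {P K E : Type*} [CommRing P] [IsDomain P] [Field K]
    [Algebra P K] [IsFractionRing P K] [CommRing E] [Algebra K E] [Algebra P E]
    [IsScalarTower P K E] (Y : Set E) {e : E} (he : e ∈ Algebra.adjoin K Y) :
    ∃ f : P, f ≠ 0 ∧ f • e ∈ Algebra.adjoin P Y := by
  induction he using Algebra.adjoin_induction with
  | mem x hx => exact ⟨1, one_ne_zero, by rw [one_smul]; exact Algebra.subset_adjoin hx⟩
  | algebraMap r =>
    obtain ⟨a, b, hb, rfl⟩ := IsFractionRing.div_surjective P r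
    refine ⟨b, nonZeroDivisors.ne_zero hb, ?_⟩
    have hbK : algebraMap P K b ≠ 0 := by
      rw [Ne, IsFractionRing.to_map_eq_zero_iff]
      exact nonZeroDivisors.ne_zero hb
    rw [Algebra.smul_def, IsScalarTower.algebraMap_apply P K E b, ← map_mul,
      mul_div_cancel₀ _ hbK, ← IsScalarTower.algebraMap_apply P K E]
    exact Subalgebra.algebraMap_mem _ a
  | add x z _ _ hx hz =>
    obtain ⟨f, hf, hfx⟩ := hx
    obtain ⟨g, hg, hgz⟩ := hz
    refine ⟨f * g, mul_ne_zero hf hg, ?_⟩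
    rw [smul_add]
    nth_rw 1 [mul_comm]
    rw [mul_smul, mul_smul]
    exact add_mem (Subalgebra.smul_mem _ hfx g) (Subalgebra.smul_mem _ hgz f)
  | mul x z _ _ hx hz =>
    obtain ⟨f, hf, hfx⟩ := hx
    obtain ⟨g, hg, hgz⟩ := hz
    refine ⟨f * g, mul_ne_zero hf hg, ?_⟩
    rw [← smul_mul_smul_comm]
    exact mul_mem hfx hgz

/-- First clear the denominators of the coefficients. Since B may have P-torsion, the resulting
equality in K ⊗ B descends to B only after a further multiplier g. -/
theorem exists_smul_mem_adjoin_of_tmul {P K B : Type*} [CommRing P] [IsDomain P] [Field K]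
    [Algebra P K] [IsFractionRing P K] [CommRing B] [Algebra P B] {ι : Type*} (y : ι → B) (b : B)
    (hb : (1 : K) ⊗ₜ[P] b ∈ Algebra.adjoin K (Set.range fun j => (1 : K) ⊗ₜ[P] y j)) :
    ∃ f : P, f ≠ 0 ∧ f • b ∈ Algebra.adjoin P (Set.range y) := by
  let inc : B →ₐ[P] K ⊗[P] B := Algebra.TensorProduct.includeRight
  obtain ⟨f, hf, hfb⟩ := exists_smul_eq_of_mem_adjoin (P := P) _ hb
  have hrange : (Set.range fun j => (1 : K) ⊗ₜ[P] y j) = inc '' Set.range y := by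
    rw [← Set.range_comp]
    rfl
  rw [hrange, Algebra.adjoin_image] at hfb
  obtain ⟨c, hc, hfc⟩ := hfb
  have hloc : IsLocalizedModule (nonZeroDivisors P) (TensorProduct.mk P K B 1) :=
    (isLocalizedModule_iff_isBaseChange (nonZeroDivisors P) K _).mpr (TensorProduct.isBaseChange P B K)
  have heq : TensorProduct.mk P K B 1 (f • b) = TensorProduct.mk P K B 1 c := by
    rw [map_smul]
    exact hfc.symm
  obtain ⟨g, hg⟩ := (IsLocalizedModule.eq_iff_exists (nonZeroDivisors P) _).mp heq
  refine ⟨g * f, mul_ne_zero (nonZeroDivisors.ne_zero g.2) hf, ?_⟩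
  have : (g * f : P) • b = (g : P) • c := by
    rw [mul_smul]
    exact hg
  rw [this]
  exact Subalgebra.smul_mem _ hc g

/-- If elements `y j` of a finite algebra `B` over a domain `P` kill all derivations into generic
residue fields and separate the geometric points over `K = Frac P`, then they generate `B`
generically over `P`. -/
theorem exists_smul_mem_adjoin {P K : Type u} {B : Type v} [CommRing P] [IsDomain P] [Field K]
    [Algebra P K] [IsFractionRing P K] [CommRing B]
    [Algebra P B] [Module.Finite P B] (Ω : Type*) [Field Ω] [IsAlgClosed Ω] [Algebra K Ω]
    [Algebra P Ω] [IsScalarTower P K Ω] {ι : Type*} (y : ι → B)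
    (h1 : ∀ (F : Type (max u v)) [Field F] [Algebra B F] [Algebra P F] [IsScalarTower P B F],
      (∀ f : P, algebraMap P F f = 0 → f = 0) →
      ∀ D : Derivation P B F, (∀ j, D (y j) = 0) → D = 0)
    (h2 : ∀ φ ψ : B →ₐ[P] Ω, (∀ j, φ (y j) = ψ (y j)) → φ = ψ)
    (b : B) : ∃ f : P, f ≠ 0 ∧ f • b ∈ Algebra.adjoin P (Set.range y) := by
  refine exists_smul_mem_adjoin_of_tmul (K := K) y b ?_
  generalize hS : Algebra.adjoin K (Set.range fun j => (1 : K) ⊗ₜ[P] y j) = S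
  have hy : ∀ j, (1 : K) ⊗ₜ[P] y j ∈ S := fun j => hS ▸ Algebra.subset_adjoin ⟨j, rfl⟩
  clear hS
  suffices h : S = ⊤ by rw [h]; trivial
  have : Module.Finite S (K ⊗[P] B) := Module.Finite.of_restrictScalars_finite K S _
  refine Subalgebra.eq_top_of_unramified Ω S ?_ ?_
  · refine subsingleton_kaehlerDifferential fun M hM D => ?_
    refine derivation_tensorProduct_eq_zero S D ?_
    let : Field ((K ⊗[P] B) ⧸ M) := Ideal.Quotient.field M
    let inc : B →ₐ[P] K ⊗[P] B := Algebra.TensorProduct.includeRight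
    let : Algebra B ((K ⊗[P] B) ⧸ M) := ((Ideal.Quotient.mk M).comp inc.toRingHom).toAlgebra
    have hPB : IsScalarTower P B ((K ⊗[P] B) ⧸ M) := by
      refine IsScalarTower.of_algebraMap_eq fun f => ?_
      change algebraMap P ((K ⊗[P] B) ⧸ M) f = Ideal.Quotient.mk M (inc (algebraMap P B f))
      rw [AlgHom.commutes]
      rfl
    have hinj : ∀ f : P, algebraMap P ((K ⊗[P] B) ⧸ M) f = 0 → f = 0 := by
      intro f hf
      rw [IsScalarTower.algebraMap_apply P K ((K ⊗[P] B) ⧸ M), map_eq_zero] at hf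
      exact (IsFractionRing.injective P K) (by rw [hf, map_zero])
    -- The pullback of D to B; it takes values in a K-algebra, so P injects into the target as `h1`
    -- requires.
    let D' : Derivation P B ((K ⊗[P] B) ⧸ M) := Derivation.mk'
      { toFun := fun b => D (inc b)
        map_add' := fun a b => by rw [map_add, map_add]
        map_smul' := fun f b => by
          have h3 : inc (f • b) = algebraMap S (K ⊗[P] B) (algebraMap K S (algebraMap P K f)) *
              inc b := by
            rw [map_smul, Algebra.smul_def]
            rfl
          rw [h3, ← Algebra.smul_def, Derivation.map_smul, RingHom.id_apply]
          rw [algebraMap_smul, algebraMap_smul] } (by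
        intro a b
        change D (inc (a * b)) = a • D (inc b) + b • D (inc a)
        rw [map_mul, Derivation.leibniz]
        rfl)
    have hD' : D' = 0 := by
      refine h1 _ hinj D' fun j => ?_
      exact D.map_algebraMap ⟨_, hy j⟩
    exact fun b => Derivation.congr_fun hD' b
  · intro φ ψ hφψ
    refine Algebra.TensorProduct.ext (by ext) ?_
    exact h2 _ _ fun j => hφψ _ (hy j)

end Unramified

/-! ### Derivations into residue fields over a perfect field -/

section Derivations

open IsLocalRing

/-- Over a perfect field, derivations of a finitely generated field extension are determined by
their values on some transcendence basis. -/
theorem exists_finset_derivation_eq_zero (k κ : Type*) [Field k] [PerfectField k] [Field κ]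
    [Algebra k κ] [Algebra.EssFiniteType k κ] :
    ∃ s : Finset κ, (s.card : Cardinal) = Algebra.trdeg k κ ∧
      ∀ D : Derivation k κ κ, (∀ t ∈ s, D t = 0) → D = 0 := by
  obtain ⟨s, hs, hsep⟩ := exists_isTranscendenceBasis_and_isSeparable_of_perfectField k κ
  refine ⟨s, ?_, fun D hD => ?_⟩
  · rw [← hs.cardinalMk_eq_trdeg]
    simp
  -- A derivation killing the separating transcendence basis s is L-linear, and κ is separable
  -- algebraic over L, so it vanishes.
  · set L := IntermediateField.adjoin k (s : Set κ)
    have hL : ∀ l ∈ L, D l = 0 := by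
      intro l hl
      induction hl using IntermediateField.adjoin_induction with
      | mem x hx => exact hD x hx
      | algebraMap x => exact D.map_algebraMap x
      | add x y _ _ hx hy => rw [map_add, hx, hy, add_zero]
      | inv x _ hx => rw [Derivation.leibniz_inv, hx, smul_zero]
      | mul x y _ _ hx hy => rw [Derivation.leibniz, hx, hy, smul_zero, smul_zero, add_zero]
    let D' : Derivation L κ κ := Derivation.mk'
      { toFun := D
        map_add' := map_add D
        map_smul' := fun l x => by
          rw [Algebra.smul_def, Derivation.leibniz, hL (algebraMap L κ l) l.2, smul_zero, add_zero,
            RingHom.id_apply, smul_eq_mul, Algebra.smul_def] } (fun a b => D.leibniz a b)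
    have hun : Algebra.FormallyUnramified L κ := Algebra.FormallyUnramified.of_isSeparable L κ
    have hsub : Subsingleton (Derivation L κ κ) :=
      (KaehlerDifferential.linearMapEquivDerivation L κ (M := κ)).symm.toEquiv.subsingleton
    have : D' = 0 := Subsingleton.elim _ _
    ext x
    exact Derivation.congr_fun this x

/-- Take lifts of a separating transcendence basis of the residue field together with minimal
generators of the maximal ideal. The maximal ideal acts by zero on the target, so a derivation
killing its generators kills it and descends to the residue field. -/
theorem exists_finset_derivation_residueField_eq_zero (k R : Type*) [Field k] [PerfectField k]
    [CommRing R] [IsLocalRing R] [IsNoetherianRing R] [Algebra k R]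
    [Algebra.EssFiniteType k (ResidueField R)] {d : ℕ}
    (hd : Algebra.trdeg k (ResidueField R) ≤ d) :
    ∃ G : Finset R, G.card ≤ d + embeddingDimension R ∧
      ∀ D : Derivation k R (ResidueField R), (∀ g ∈ G, D g = 0) → D = 0 := by
  classical
  obtain ⟨s, hs, hsD⟩ := exists_finset_derivation_eq_zero k (ResidueField R)
  have hfg : (maximalIdeal R).FG := (isNoetherianRing_iff_ideal_fg _).mp inferInstance _
  obtain ⟨G, hGcard, hGspan⟩ := Submodule.FG.exists_span_finset_card_eq_spanFinrank hfg
  have hsurj : Function.Surjective (residue R) := residue_surjective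
  let σ := Function.surjInv hsurj
  have hσ : ∀ x, residue R (σ x) = x := Function.surjInv_eq hsurj
  refine ⟨s.image σ ∪ G, ?_, fun D hD => ?_⟩
  · refine (Finset.card_union_le _ _).trans (add_le_add (Finset.card_image_le.trans ?_) ?_)
    · rw [← hs] at hd
      exact_mod_cast hd
    · rw [hGcard, spanFinrank_maximalIdeal_eq_finrank_cotangentSpace]
      rfl
  · have hsmul : ∀ (r : R) (x : ResidueField R), r • x = residue R r * x := fun r x =>
      Algebra.smul_def r x
    have hmax : ∀ m ∈ maximalIdeal R, D m = 0 := by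
      intro m hm
      rw [← hGspan] at hm
      induction hm using Submodule.span_induction with
      | mem x hx => exact hD x (Finset.mem_union_right _ hx)
      | zero => rw [map_zero]
      | add x y _ _ hx hy => rw [map_add, hx, hy, add_zero]
      | smul a x hx ih =>
        have hx' : x ∈ maximalIdeal R := by rw [← hGspan]; exact hx
        rw [smul_eq_mul, Derivation.leibniz, ih, smul_zero, hsmul,
          (residue_eq_zero_iff x).mpr hx', zero_mul, add_zero]
    have hwell : ∀ a b, residue R a = residue R b → D a = D b := by
      intro a b hab
      rw [← sub_eq_zero, ← map_sub]
      refine hmax _ ?_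
      rw [← residue_eq_zero_iff, map_sub, hab, sub_self]
    let D' : Derivation k (ResidueField R) (ResidueField R) := Derivation.mk'
      { toFun := fun x => D (σ x)
        map_add' := fun x y => by
          rw [← map_add]
          exact hwell _ _ (by rw [map_add, hσ, hσ, hσ])
        map_smul' := fun c x => by
          rw [RingHom.id_apply, ← D.map_smul]
          refine hwell _ _ ?_
          rw [hσ, Algebra.smul_def, Algebra.smul_def, map_mul, hσ]
          rfl } (fun x y => by
        change D (σ (x * y)) = x • D (σ y) + y • D (σ x)
        rw [hwell (σ (x * y)) (σ x * σ y) (by rw [map_mul, hσ, hσ, hσ]), Derivation.leibniz,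
          hsmul, hsmul, hσ, hσ, smul_eq_mul, smul_eq_mul])
    have hD' : D' = 0 := hsD D' fun t ht =>
      hD _ (Finset.mem_union_left _ (Finset.mem_image_of_mem σ ht))
    ext r
    have h1 : D' (residue R r) = 0 := Derivation.congr_fun hD' _
    rw [Derivation.zero_apply, ← h1]
    exact hwell _ _ (hσ _).symm

/-- Localization is formally étale, so differentials commute with it. -/
theorem exists_derivation_localization (k : Type*) {B : Type*} [Field k] [CommRing B] [Algebra k B]
    (q : Ideal B) [q.IsPrime] (D : Derivation k B q.ResidueField) :
    ∃ D' : Derivation k (Localization.AtPrime q) q.ResidueField,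
      ∀ b, D' (algebraMap B _ b) = D b := by
  have : Algebra.FormallyEtale B (Localization.AtPrime q) :=
    Algebra.FormallyEtale.of_isLocalization q.primeCompl
  let e := KaehlerDifferential.tensorKaehlerEquivOfFormallyEtale k B (Localization.AtPrime q)
  let f := D.liftKaehlerDifferential.liftBaseChange (Localization.AtPrime q)
  refine ⟨(f ∘ₗ e.symm.toLinearMap).compDer (KaehlerDifferential.D k _), fun b => ?_⟩
  change f (e.symm (KaehlerDifferential.D k _ (algebraMap B _ b))) = D b
  rw [KaehlerDifferential.tensorKaehlerEquivOfFormallyEtale_symm_D_algebraMap]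
  simp [f]

/-- Over a perfect field, the dimension of the space of derivations into the residue field at a
prime is at most the transcendence degree plus the embedding dimension. -/
theorem finrank_derivation_le {k B : Type*} [Field k] [PerfectField k] [CommRing B] [Algebra k B]
    [Algebra.FiniteType k B] (q : Ideal B) [q.IsPrime] {d : ℕ}
    (hd : Algebra.trdeg k q.ResidueField ≤ d) :
    Module.Finite q.ResidueField (Derivation k B q.ResidueField) ∧
    Module.finrank q.ResidueField (Derivation k B q.ResidueField) ≤
      d + embeddingDimension (Localization.AtPrime q) := by
  have hnoeth : IsNoetherianRing B := Algebra.FiniteType.isNoetherianRing k B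
  have hnoeth' : IsNoetherianRing (Localization.AtPrime q) :=
    IsLocalization.isNoetherianRing q.primeCompl _ inferInstance
  have hess1 : Algebra.EssFiniteType B (Localization.AtPrime q) :=
    Algebra.EssFiniteType.of_isLocalization _ q.primeCompl
  have hess2 : Algebra.FiniteType (Localization.AtPrime q) q.ResidueField :=
    Algebra.FiniteType.of_surjective (Algebra.ofId (Localization.AtPrime q) q.ResidueField)
      IsLocalRing.residue_surjective
  have hess3 : Algebra.EssFiniteType k (Localization.AtPrime q) :=
    Algebra.EssFiniteType.comp k B (Localization.AtPrime q)
  have hess : Algebra.EssFiniteType k q.ResidueField :=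
    Algebra.EssFiniteType.comp k (Localization.AtPrime q) q.ResidueField
  obtain ⟨G, hG, hGD⟩ := exists_finset_derivation_residueField_eq_zero k
    (Localization.AtPrime q) hd
  let ev : Derivation k (Localization.AtPrime q) q.ResidueField →ₗ[q.ResidueField]
      (G → q.ResidueField) :=
    { toFun := fun D g => D g
      map_add' := fun _ _ => rfl
      map_smul' := fun _ _ => rfl }
  have hev : Function.Injective ev := by
    rw [injective_iff_map_eq_zero]
    intro D hD
    exact hGD D fun g hg => congrFun hD ⟨g, hg⟩
  let res : Derivation k (Localization.AtPrime q) q.ResidueField →ₗ[q.ResidueField]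
      Derivation k B q.ResidueField :=
    { toFun := fun D => D.compAlgebraMap B
      map_add' := fun _ _ => rfl
      map_smul' := fun _ _ => rfl }
  have hres : Function.Surjective res := by
    intro D
    obtain ⟨D', hD'⟩ := exists_derivation_localization k q D
    exact ⟨D', Derivation.ext hD'⟩
  have hfin : Module.Finite q.ResidueField
      (Derivation k (Localization.AtPrime q) q.ResidueField) := Module.Finite.of_injective ev hev
  refine ⟨Module.Finite.of_surjective res hres, ?_⟩
  refine (LinearMap.finrank_le_finrank_of_surjective hres).trans ?_
  refine (LinearMap.finrank_le_finrank_of_injective hev).trans ?_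
  rw [Module.finrank_fintype_fun_eq_card, Fintype.card_coe]
  exact hG

/-- A derivation into a field is zero if derivations into the residue field of its centre with the
same constraints are zero. -/
theorem derivation_eq_zero_of_residueField {k B F : Type*} [Field k] [CommRing B] [Algebra k B]
    [Field F] [Algebra B F] [Algebra k F] [IsScalarTower k B F] (q : Ideal B) [q.IsPrime]
    (hq : ∀ b, algebraMap B F b = 0 ↔ b ∈ q) (T : Set B)
    (hT : ∀ D : Derivation k B q.ResidueField, (∀ t ∈ T, D t = 0) → D = 0)
    (D : Derivation k B F) (hD : ∀ t ∈ T, D t = 0) : D = 0 := by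
  let ι : q.ResidueField →+* F := Ideal.ResidueField.lift q (algebraMap B F)
    (fun b hb => (hq b).mpr hb)
    (fun b hb => isUnit_iff_ne_zero.mpr fun h => hb ((hq b).mp h))
  let : Algebra q.ResidueField F := ι.toAlgebra
  have : IsScalarTower B q.ResidueField F :=
    IsScalarTower.of_algebraMap_eq fun b => (Ideal.ResidueField.lift_algebraMap q _ _ _ b).symm
  have : IsScalarTower k q.ResidueField F := IsScalarTower.of_algebraMap_eq fun c => by
    rw [IsScalarTower.algebraMap_apply k B F, IsScalarTower.algebraMap_apply k B q.ResidueField,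
      ← IsScalarTower.algebraMap_apply B q.ResidueField F]
  ext b
  rw [Derivation.zero_apply]
  by_contra hne
  -- A functional on F over the residue field of q turns D into a derivation with values in that
  -- residue field, still nonzero at b.
  obtain ⟨l, hl⟩ := Module.Projective.exists_dual_ne_zero q.ResidueField hne
  have h0 : (l.restrictScalars B).compDer D = 0 := by
    refine hT _ fun t ht => ?_
    change l (D t) = 0
    rw [hD t ht, map_zero]
  exact hl (Derivation.congr_fun h0 b)

end Derivations

/-! ### Choosing linear forms in general position -/

section Choice

theorem exists_notMem_of_forall_ne_top {k V ι : Type*} [Field k] [Infinite k] [AddCommGroup V]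
    [Module k V] [Finite ι] (p : ι → Submodule k V) (hp : ∀ i, p i ≠ ⊤) : ∃ v, ∀ i, v ∉ p i := by
  by_contra! hcon
  obtain ⟨i, hi⟩ := Subspace.exists_eq_top_of_iUnion_eq_univ (p := p)
    (Set.eq_univ_of_forall fun v => Set.mem_iUnion.mpr (hcon v))
  exact hp i hi

variable (k : Type*) {B : Type*} [Field k] [CommRing B] [Algebra k B]

/-- The derivations into the residue field at `q` which vanish on a given set. -/
def derivationsVanishingOn (q : PrimeSpectrum B) (T : Set B) :
    Submodule q.asIdeal.ResidueField (Derivation k B q.asIdeal.ResidueField) where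
  carrier := {D | ∀ t ∈ T, D t = 0}
  add_mem' := fun ha hb t ht => by rw [Derivation.add_apply, ha t ht, hb t ht, add_zero]
  zero_mem' := fun _ _ => rfl
  smul_mem' := fun c D hD t ht => by rw [Derivation.smul_apply, hD t ht, smul_zero]

variable {k}
variable {𝒜 : ℕ → Submodule k B} [GradedAlgebra 𝒜]

/-- A nonzero derivation cannot vanish on all of B_1, which generates B. Choosing one D for each q
whose space is nonzero, v has to avoid only finitely many proper subspaces of B_1. Truncated
subtraction covers the spaces that are already zero. -/
theorem IsStandardGraded.exists_step [Infinite k] (hB : IsStandardGraded 𝒜)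
    (Q : Finset (PrimeSpectrum B))
    (hQ : ∀ q ∈ Q, Module.Finite q.asIdeal.ResidueField (Derivation k B q.asIdeal.ResidueField))
    (T : Set B) {ι : Type*} [Finite ι] (p : ι → Submodule k (𝒜 1)) (hp : ∀ i, p i ≠ ⊤) :
    ∃ v : 𝒜 1, (∀ i, v ∉ p i) ∧ ∀ q ∈ Q,
      Module.finrank q.asIdeal.ResidueField (derivationsVanishingOn k q (insert (v : B) T)) ≤
        Module.finrank q.asIdeal.ResidueField (derivationsVanishingOn k q T) - 1 := by
  have hD : ∀ q : {q // q ∈ Q ∧ derivationsVanishingOn k q T ≠ ⊥},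
      ∃ D ∈ derivationsVanishingOn k q.1 T, D ≠ 0 := fun q => Submodule.exists_mem_ne_zero_of_ne_bot q.2.2
  choose D hDT hD0 using hD
  have : Finite {q // q ∈ Q ∧ derivationsVanishingOn k q T ≠ ⊥} :=
    Finite.of_injective (fun q => (⟨q.1, q.2.1⟩ : Q)) fun a b h => Subtype.ext (by simpa using h)
  obtain ⟨v, hv⟩ := exists_notMem_of_forall_ne_top
    (Sum.elim p fun q => LinearMap.ker ((D q).toLinearMap ∘ₗ (𝒜 1).subtype)) (by
      rintro (i | q)
      · exact hp i
      · intro htop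
        refine hD0 q (Derivation.ext_of_adjoin_eq_top _ hB.adjoin_degree_one fun b hb => ?_)
        have : (⟨b, hb⟩ : 𝒜 1) ∈ LinearMap.ker ((D q).toLinearMap ∘ₗ (𝒜 1).subtype) := by
          have h2 : LinearMap.ker ((D q).toLinearMap ∘ₗ (𝒜 1).subtype) = ⊤ := htop
          rw [h2]
          trivial
        exact this)
  refine ⟨v, fun i => hv (Sum.inl i), fun q hq => ?_⟩
  have := hQ q hq
  have hle : derivationsVanishingOn k q (insert (v : B) T) ≤ derivationsVanishingOn k q T :=
    fun E hE t ht => hE t (Set.mem_insert_of_mem _ ht)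
  by_cases hbot : derivationsVanishingOn k q T = ⊥
  · rw [hbot, le_bot_iff] at hle
    rw [hle, finrank_bot]
    exact Nat.zero_le _
  · have hlt : derivationsVanishingOn k q (insert (v : B) T) < derivationsVanishingOn k q T := by
      refine lt_of_le_of_ne hle fun heq => ?_
      have h1 : D ⟨q, hq, hbot⟩ ∈ derivationsVanishingOn k q (insert (v : B) T) := by
        rw [heq]
        exact hDT ⟨q, hq, hbot⟩
      have h2 : D ⟨q, hq, hbot⟩ (v : B) = 0 := h1 v (Set.mem_insert _ _)
      exact hv (Sum.inr ⟨q, hq, hbot⟩) (LinearMap.mem_ker.mpr h2)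
    exact Nat.le_sub_one_of_lt (Submodule.finrank_lt_finrank_of_lt hlt)

theorem IsStandardGraded.irrelevant_ne_top (hB : IsStandardGraded 𝒜) :
    (HomogeneousIdeal.irrelevant 𝒜).toIdeal ≠ ⊤ := by
  have := hB.nontrivial
  intro h
  have h1 : (1 : B) ∈ (HomogeneousIdeal.irrelevant 𝒜).toIdeal := by rw [h]; trivial
  rw [HomogeneousIdeal.mem_iff, HomogeneousIdeal.mem_irrelevant_iff,
    proj_of_mem (SetLike.one_mem_graded 𝒜)] at h1
  exact one_ne_zero h1

/-- Linear forms chosen successively outside the relevant minimal primes cut down the dimension,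
and can at the same time be chosen to cut down finitely many spaces of derivations. -/
theorem IsStandardGraded.exists_parameters_aux [Infinite k] (hB : IsStandardGraded 𝒜) {d n : ℕ}
    (hdim : ringKrullDim B = d) (Q : Finset (PrimeSpectrum B))
    (hQ : ∀ q ∈ Q, Module.Finite q.asIdeal.ResidueField (Derivation k B q.asIdeal.ResidueField) ∧
      Module.finrank q.asIdeal.ResidueField (Derivation k B q.asIdeal.ResidueField) ≤ n) (i : ℕ) :
    ∃ x : Fin i → 𝒜 1,
      (∀ P ∈ (Ideal.span (Set.range fun j => (x j : B))).minimalPrimes,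
        ¬ (HomogeneousIdeal.irrelevant 𝒜).toIdeal ≤ P → ringKrullDim (B ⧸ P) + i ≤ d) ∧
      ∀ q ∈ Q, Module.finrank q.asIdeal.ResidueField
        (derivationsVanishingOn k q (Set.range fun j => (x j : B))) ≤ n - i := by
  have hnoeth := hB.isNoetherianRing
  induction i with
  | zero =>
    refine ⟨Fin.elim0, fun P _ _ => ?_, fun q hq => ?_⟩
    · rw [Nat.cast_zero, add_zero, ← hdim]
      exact _root_.ringKrullDim_quotient_le P
    · have := (hQ q hq).1
      exact (Submodule.finrank_le _).trans (hQ q hq).2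
  | succ i ih =>
    obtain ⟨x, hx, hxQ⟩ := ih
    set T : Set B := Set.range fun j => (x j : B) with hT
    have hfin : ((Ideal.span T).minimalPrimes).Finite :=
      Ideal.finite_minimalPrimes_of_isNoetherianRing B _
    have : Finite {P // P ∈ (Ideal.span T).minimalPrimes ∧
        ¬ (HomogeneousIdeal.irrelevant 𝒜).toIdeal ≤ P} :=
      (hfin.subset fun P hP => hP.1 : {P | P ∈ (Ideal.span T).minimalPrimes ∧
        ¬ (HomogeneousIdeal.irrelevant 𝒜).toIdeal ≤ P}.Finite).to_subtype
    -- Since B_1 generates 𝔪, a prime not containing 𝔪 meets B_1 in a proper subspace.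
    obtain ⟨v, hv, hvQ⟩ := hB.exists_step Q (fun q hq => (hQ q hq).1) T
      (fun P : {P // P ∈ (Ideal.span T).minimalPrimes ∧
        ¬ (HomogeneousIdeal.irrelevant 𝒜).toIdeal ≤ P} =>
          (P.1.restrictScalars k).comap (𝒜 1).subtype) (by
        rintro ⟨P, hP, hmP⟩ htop
        apply hmP
        rw [hB.irrelevant_eq, Ideal.span_le]
        intro b hb
        have : (⟨b, hb⟩ : 𝒜 1) ∈ (P.restrictScalars k).comap (𝒜 1).subtype := by
          rw [htop]
          trivial
        exact this)
    have hrange : Set.range (fun j => ((Fin.cons v x : Fin (i + 1) → 𝒜 1) j : B)) =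
        insert (v : B) T := by
      ext b
      simp only [Set.mem_range, Fin.exists_fin_succ, Fin.cons_zero, Fin.cons_succ, hT,
        Set.mem_insert_iff, eq_comm]
    refine ⟨Fin.cons v x, ?_, ?_⟩
    · rw [hrange]
      intro P hP hmP
      have hPp : P.IsPrime := hP.1.1
      obtain ⟨P', hP', hle⟩ := Ideal.exists_minimalPrimes_le
        ((Ideal.span_mono (Set.subset_insert (v : B) T)).trans hP.1.2)
      have hP'p : P'.IsPrime := hP'.1.1
      have hmP' : ¬ (HomogeneousIdeal.irrelevant 𝒜).toIdeal ≤ P' := fun h => hmP (h.trans hle)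
      have hvP' : (v : B) ∉ P' := hv ⟨P', hP', hmP'⟩
      have hvP : (v : B) ∈ P := hP.1.2 (Ideal.subset_span (Set.mem_insert _ _))
      have hlt : P' < P := lt_of_le_of_ne hle (by rintro rfl; exact hvP' hvP)
      have h1 := ringKrullDim_quotient_succ_le_of_lt hlt
      have h2 := hx P' hP' hmP'
      calc ringKrullDim (B ⧸ P) + ((i + 1 : ℕ) : WithBot ℕ∞)
          = ringKrullDim (B ⧸ P) + 1 + i := by
            rw [Nat.cast_add, Nat.cast_one, add_assoc, add_comm (i : WithBot ℕ∞)]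
        _ ≤ ringKrullDim (B ⧸ P') + i := add_le_add_left h1 _
        _ ≤ d := h2
    · rw [hrange]
      intro q hq
      refine (hvQ q hq).trans ?_
      have := hxQ q hq
      omega

/-- Linear Noether normalization over an infinite field, with control on derivations. -/
theorem IsStandardGraded.exists_parameters [Infinite k] (hB : IsStandardGraded 𝒜) {d n : ℕ}
    (hdim : ringKrullDim B = d) (Q : Finset (PrimeSpectrum B))
    (hQ : ∀ q ∈ Q, Module.Finite q.asIdeal.ResidueField (Derivation k B q.asIdeal.ResidueField) ∧
      Module.finrank q.asIdeal.ResidueField (Derivation k B q.asIdeal.ResidueField) ≤ n) :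
    ∃ x : Fin d → 𝒜 1,
      (HomogeneousIdeal.irrelevant 𝒜).toIdeal ≤
        (Ideal.span (Set.range fun j => (x j : B))).radical ∧
      ∀ q ∈ Q, Module.finrank q.asIdeal.ResidueField
        (derivationsVanishingOn k q (Set.range fun j => (x j : B))) ≤ n - d := by
  obtain ⟨x, hx, hxQ⟩ := hB.exists_parameters_aux hdim Q hQ d
  refine ⟨x, ?_, hxQ⟩
  rw [← Ideal.sInf_minimalPrimes]
  refine le_sInf fun P hP => ?_
  -- A minimal prime P over (x_1, …, x_d) not containing 𝔪 would satisfy dim B/P ≤ 0, yet it is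
  -- homogeneous, hence strictly inside 𝔪, and dim B/P ≥ 1.
  by_contra hmP
  have hPp : P.IsPrime := hP.1.1
  have hPh : P.IsHomogeneous 𝒜 := isHomogeneous_of_mem_minimalPrimes
    (isHomogeneous_span_of_subset_graded (e := 1) (by rintro _ ⟨j, rfl⟩; exact (x j).2)) hP
  have hlt : P < (HomogeneousIdeal.irrelevant 𝒜).toIdeal :=
    lt_of_le_of_ne (hB.le_irrelevant hPh hPp.ne_top) fun h => hmP h.ge
  have h1 := ringKrullDim_quotient_succ_le_of_lt hlt
  have h2 := hx P hP hmP
  have : Nontrivial (B ⧸ (HomogeneousIdeal.irrelevant 𝒜).toIdeal) :=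
    Ideal.Quotient.nontrivial_iff.mpr hB.irrelevant_ne_top
  have h3 : (0 : WithBot ℕ∞) ≤ ringKrullDim (B ⧸ (HomogeneousIdeal.irrelevant 𝒜).toIdeal) :=
    ringKrullDim_nonneg_of_nontrivial
  have h4 : (0 : WithBot ℕ∞) + 1 + d ≤ d :=
    (add_le_add_left ((add_le_add_left h3 1).trans h1) _).trans h2
  rw [zero_add] at h4
  have h5 : 1 + d ≤ d := by exact_mod_cast h4
  omega

theorem IsStandardGraded.exists_forms_aux [Infinite k] (hB : IsStandardGraded 𝒜)
    (Q : Finset (PrimeSpectrum B))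
    (hQ : ∀ q ∈ Q, Module.Finite q.asIdeal.ResidueField (Derivation k B q.asIdeal.ResidueField))
    (T : Set B) (s : ℕ) :
    ∃ y : Fin s → 𝒜 1, ∀ q ∈ Q, Module.finrank q.asIdeal.ResidueField
        (derivationsVanishingOn k q (Set.range (fun j => (y j : B)) ∪ T)) ≤
      Module.finrank q.asIdeal.ResidueField (derivationsVanishingOn k q T) - s := by
  induction s with
  | zero => exact ⟨Fin.elim0, fun q _ => by rw [Set.range_eq_empty, Set.empty_union, Nat.sub_zero]⟩
  | succ s ih =>
    obtain ⟨y, hy⟩ := ih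
    obtain ⟨v, -, hv⟩ := hB.exists_step Q hQ (Set.range (fun j => (y j : B)) ∪ T)
      (fun i : Empty => i.elim) (fun i => i.elim)
    refine ⟨Fin.cons v y, fun q hq => ?_⟩
    have hrange : Set.range (fun j => ((Fin.cons v y : Fin (s + 1) → 𝒜 1) j : B)) ∪ T =
        insert (v : B) (Set.range (fun j => (y j : B)) ∪ T) := by
      ext b
      simp only [Set.mem_union, Set.mem_range, Fin.exists_fin_succ, Fin.cons_zero, Fin.cons_succ,
        Set.mem_insert_iff, eq_comm, or_assoc]
    rw [hrange]
    have := hv q hq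
    have := hy q hq
    omega

/-- Linear forms which cut down finitely many spaces of derivations and separate finitely many
points. -/
theorem IsStandardGraded.exists_forms [Infinite k] (hB : IsStandardGraded 𝒜)
    (Q : Finset (PrimeSpectrum B))
    (hQ : ∀ q ∈ Q, Module.Finite q.asIdeal.ResidueField (Derivation k B q.asIdeal.ResidueField))
    (T : Set B) {s : ℕ} (hs : 1 ≤ s) {Ω : Type*} [CommRing Ω] [Algebra k Ω]
    (Z : Set (B →ₐ[k] Ω)) (hZ : Z.Finite) :
    ∃ y : Fin s → 𝒜 1,
      (∀ φ ∈ Z, ∀ ψ ∈ Z, (∀ j, φ (y j) = ψ (y j)) → φ = ψ) ∧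
      ∀ q ∈ Q, Module.finrank q.asIdeal.ResidueField
        (derivationsVanishingOn k q (Set.range (fun j => (y j : B)) ∪ T)) ≤
      Module.finrank q.asIdeal.ResidueField (derivationsVanishingOn k q T) - s := by
  obtain ⟨t, rfl⟩ : ∃ t, s = t + 1 := ⟨s - 1, by omega⟩
  obtain ⟨y, hy⟩ := hB.exists_forms_aux Q hQ T t
  have := hZ.to_subtype
  -- The last form does both jobs: distinct homomorphisms differ on B_1, so equality of their values
  -- at v is a proper linear condition for each of the finitely many pairs. This uses s ≥ 1.
  obtain ⟨v, hvp, hv⟩ := hB.exists_step Q hQ (Set.range (fun j => (y j : B)) ∪ T)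
    (fun p : {p : Z × Z // p.1 ≠ p.2} =>
      LinearMap.ker ((p.1.1.1.toLinearMap - p.1.2.1.toLinearMap) ∘ₗ (𝒜 1).subtype)) (by
      rintro ⟨⟨φ, ψ⟩, hne⟩ htop
      apply hne
      refine Subtype.ext (AlgHom.ext_of_adjoin_eq_top hB.adjoin_degree_one fun b hb => ?_)
      have h : (⟨b, hb⟩ : 𝒜 1) ∈
          LinearMap.ker ((φ.1.toLinearMap - ψ.1.toLinearMap) ∘ₗ (𝒜 1).subtype) := by
        rw [htop]
        trivial
      exact sub_eq_zero.mp h)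
  refine ⟨Fin.cons v y, ?_, fun q hq => ?_⟩
  · intro φ hφ ψ hψ h
    by_contra hne
    refine hvp ⟨⟨⟨φ, hφ⟩, ⟨ψ, hψ⟩⟩, fun h => hne (congrArg Subtype.val h)⟩ ?_
    exact sub_eq_zero.mpr (h 0)
  · have hrange : Set.range (fun j => ((Fin.cons v y : Fin (t + 1) → 𝒜 1) j : B)) ∪ T =
        insert (v : B) (Set.range (fun j => (y j : B)) ∪ T) := by
      ext b
      simp only [Set.mem_union, Set.mem_range, Fin.exists_fin_succ, Fin.cons_zero, Fin.cons_succ,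
        Set.mem_insert_iff, eq_comm, or_assoc]
    rw [hrange]
    have := hv q hq
    have := hy q hq
    omega

end Choice

/-! ### Generic generators over a linear Noether normalization -/

section Existence

open scoped TensorProduct

/-- B is integral over the image of k[x], so the residue field is algebraic over a subalgebra with d
generators. -/
theorem trdeg_residueField_le {k B : Type*} [Field k] [CommRing B] [Algebra k B] {d : ℕ}
    (x : Fin d → B)
    (hx : (MvPolynomial.aeval x : MvPolynomial (Fin d) k →ₐ[k] B).toRingHom.Finite)
    (q : Ideal B) [q.IsPrime] : Algebra.trdeg k q.ResidueField ≤ d := by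
  let g : B →ₐ[k] q.ResidueField := IsScalarTower.toAlgHom k B q.ResidueField
  let A := Algebra.adjoin k (Set.range fun i => g (x i))
  have hA : ∀ p : MvPolynomial (Fin d) k, g (MvPolynomial.aeval x p) ∈ A := by
    intro p
    have h1 : g (MvPolynomial.aeval x p) = MvPolynomial.aeval (fun i => g (x i)) p := by
      rw [← AlgHom.comp_apply, MvPolynomial.comp_aeval]
    rw [h1]
    change _ ∈ Algebra.adjoin k _
    rw [Algebra.adjoin_range_eq_range_aeval]
    exact ⟨p, rfl⟩
  let φ : MvPolynomial (Fin d) k →+* A :=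
    (g.toRingHom.comp (MvPolynomial.aeval x : MvPolynomial (Fin d) k →ₐ[k] B).toRingHom).codRestrict
      A.toSubring hA
  have hB : ∀ b, IsAlgebraic A (g b) := by
    intro b
    obtain ⟨p, hp, hpb⟩ := hx.to_isIntegral b
    refine IsIntegral.isAlgebraic ⟨p.map φ, hp.map φ, ?_⟩
    rw [Polynomial.eval₂_map]
    have h2 := congrArg g hpb
    rw [map_zero] at h2
    rw [← h2]
    exact (Polynomial.hom_eval₂ p _ g.toRingHom b).symm
  have halg : Algebra.IsAlgebraic A q.ResidueField := by
    refine ⟨fun z => ?_⟩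
    obtain ⟨a, b, -, rfl⟩ := IsFractionRing.div_surjective (B ⧸ q) z
    obtain ⟨a, rfl⟩ := Ideal.Quotient.mk_surjective a
    obtain ⟨b, rfl⟩ := Ideal.Quotient.mk_surjective b
    rw [div_eq_mul_inv]
    exact (hB a).mul (hB b).inv
  refine (Algebra.IsAlgebraic.trdeg_le_cardinalMk k (Set.range fun i => g (x i))).trans ?_
  simpa using Cardinal.mk_range_le_lift (f := fun i => g (x i))

/-- These are points of the finite-dimensional K-algebra K ⊗ B, of which a field receives only
finitely many. -/
theorem finite_algHom_of_finite {P K B Ω : Type*} [CommRing P] [Field K] [Algebra P K] [CommRing B]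
    [Algebra P B] [Module.Finite P B] [Field Ω] [Algebra K Ω] [Algebra P Ω] [IsScalarTower P K Ω] :
    Finite (B →ₐ[P] Ω) := by
  refine Finite.of_injective (β := TensorProduct P K B →ₐ[K] Ω)
    (fun φ => Algebra.TensorProduct.lift (Algebra.ofId K Ω) φ fun _ _ => Commute.all _ _) ?_
  intro φ ψ h
  ext b
  have := AlgHom.congr_fun h (1 ⊗ₜ[P] b)
  simpa using this

theorem mem_of_mem_adjoin {k P B : Type*} [CommRing k] [CommRing P] [CommRing B] [Algebra k B]
    [Algebra P B] (A : Subalgebra k B) (hP : ∀ p, algebraMap P B p ∈ A) {Y : Set B} (hY : Y ⊆ A)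
    {c : B} (hc : c ∈ Algebra.adjoin P Y) : c ∈ A := by
  induction hc using Algebra.adjoin_induction with
  | mem x hx => exact hY hx
  | algebraMap r => exact hP r
  | add x y _ _ hx hy => exact add_mem hx hy
  | mul x y _ _ hx hy => exact mul_mem hx hy

variable {k B : Type*} [Field k] [CommRing B] [Algebra k B]
variable {𝒜 : ℕ → Submodule k B} [GradedAlgebra 𝒜]

theorem mem_minimalPrimes_of_ringKrullDim_le {q : Ideal B} [q.IsPrime] {d : ℕ}
    (hdim : ringKrullDim B = d) (hq : (d : WithBot ℕ∞) ≤ ringKrullDim (B ⧸ q)) :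
    q ∈ minimalPrimes B := by
  obtain ⟨q', hq', hle⟩ := Ideal.exists_minimalPrimes_le (bot_le : (⊥ : Ideal B) ≤ q)
  have hq'p : q'.IsPrime := hq'.1.1
  rcases hle.eq_or_lt with rfl | hlt
  · exact hq'
  · exfalso
    have h1 := ringKrullDim_quotient_succ_le_of_lt hlt
    have h2 : ((d : WithBot ℕ∞) + 1) ≤ d := by
      calc (d : WithBot ℕ∞) + 1 ≤ ringKrullDim (B ⧸ q) + 1 := add_le_add_left hq 1
        _ ≤ ringKrullDim (B ⧸ q') := h1
        _ ≤ ringKrullDim B := _root_.ringKrullDim_quotient_le q'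
        _ = d := hdim
    have h3 : d + 1 ≤ d := by exact_mod_cast h2
    omega

/-- If the generic embedding dimensions are at most `s`, then `d + s` linear forms generate the
algebra generically over a linear Noether normalization. -/
theorem IsStandardGraded.exists_generic_generators [Infinite k] [PerfectField k]
    (hB : IsStandardGraded 𝒜) {d s : ℕ} (hs : 1 ≤ s) (hdim : ringKrullDim B = d)
    (hemb : ∀ (q : Ideal B) [q.IsPrime], q ∈ minimalPrimes B → ringKrullDim (B ⧸ q) = d →
      embeddingDimension (Localization.AtPrime q) ≤ s) :
    ∃ (x : Fin d → 𝒜 1) (y : Fin s → 𝒜 1),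
      (HomogeneousIdeal.irrelevant 𝒜).toIdeal ≤
        (Ideal.span (Set.range fun j => (x j : B))).radical ∧
      ∀ b : B, ∃ f : MvPolynomial (Fin d) k, f ≠ 0 ∧
        MvPolynomial.aeval (fun j => (x j : B)) f * b ∈
          Algebra.adjoin k (Set.range (fun j => (x j : B)) ∪ Set.range (fun j => (y j : B))) := by
  classical
  have hft := hB.finiteType
  have hnoeth := hB.isNoetherianRing
  -- A preliminary normalization with no constraint on derivations: it bounds the transcendence
  -- degrees needed to bound the derivation spaces in `hQ`.
  obtain ⟨x₀, hx₀, -⟩ := hB.exists_parameters (n := 0) hdim ∅ (by simp)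
  have htr : ∀ (q : Ideal B) [q.IsPrime], Algebra.trdeg k q.ResidueField ≤ d := fun q _ =>
    trdeg_residueField_le _ (hB.finite_aeval (fun i => (x₀ i).2) hx₀) q
  have hfinQ : {q : PrimeSpectrum B | q.asIdeal ∈ minimalPrimes B ∧
      ringKrullDim (B ⧸ q.asIdeal) = d}.Finite := by
    refine Set.Finite.of_finite_image (f := PrimeSpectrum.asIdeal)
      ((minimalPrimes.finite_of_isNoetherianRing B).subset ?_)
      (fun a _ b _ h => PrimeSpectrum.ext h)
    rintro _ ⟨q, hq, rfl⟩
    exact hq.1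
  set Q := hfinQ.toFinset with hQdef
  have hQ : ∀ q ∈ Q,
      Module.Finite q.asIdeal.ResidueField (Derivation k B q.asIdeal.ResidueField) ∧
      Module.finrank q.asIdeal.ResidueField (Derivation k B q.asIdeal.ResidueField) ≤ d + s := by
    intro q hq
    rw [hQdef, Set.Finite.mem_toFinset] at hq
    obtain ⟨h1, h2⟩ := finrank_derivation_le (k := k) q.asIdeal (htr q.asIdeal)
    exact ⟨h1, h2.trans (Nat.add_le_add_left (hemb q.asIdeal hq.1 hq.2) d)⟩
  obtain ⟨x, hx, hxQ⟩ := hB.exists_parameters hdim Q hQ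
  have hfin := hB.finite_aeval (fun i => (x i).2) hx
  let P := MvPolynomial (Fin d) k
  let φ : P →ₐ[k] B := MvPolynomial.aeval fun j => (x j : B)
  let : Algebra P B := φ.toRingHom.toAlgebra
  have hPB : IsScalarTower k P B := IsScalarTower.of_algebraMap_eq fun c => (φ.commutes c).symm
  have hfinP : Module.Finite P B := hfin
  let Ω := AlgebraicClosure (FractionRing P)
  have hZ : Finite (B →ₐ[P] Ω) := finite_algHom_of_finite (K := FractionRing P)
  obtain ⟨y, hyZ, hyQ⟩ := hB.exists_forms Q (fun q hq => (hQ q hq).1)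
    (Set.range fun j => (x j : B)) hs
    (Set.range fun φ : B →ₐ[P] Ω => φ.restrictScalars k) (Set.finite_range _)
  refine ⟨x, y, hx, fun b => ?_⟩
  obtain ⟨f, hf, hfb⟩ : ∃ f : P, f ≠ 0 ∧
      f • b ∈ Algebra.adjoin P (Set.range fun j => (y j : B)) := by
    refine exists_smul_mem_adjoin (K := FractionRing P) Ω (fun j => (y j : B)) ?_ ?_ b
    · intro F _ _ _ _ hinj D hD
      -- P injects into F, so it injects into B/q, which therefore has dimension d. Thus q is one of
      -- the finitely many primes in Q.
      let q : Ideal B := RingHom.ker (algebraMap B F)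
      have hqp : q.IsPrime := RingHom.ker_isPrime _
      have hinj' : Function.Injective ((Ideal.Quotient.mk q).comp φ.toRingHom) := by
        rw [injective_iff_map_eq_zero]
        intro p hp
        refine hinj p ?_
        rw [IsScalarTower.algebraMap_apply P B F]
        exact Ideal.Quotient.eq_zero_iff_mem.mp hp
      have hint : ((Ideal.Quotient.mk q).comp φ.toRingHom).IsIntegral :=
        RingHom.IsIntegral.trans _ _ hfin.to_isIntegral
          (RingHom.isIntegral_of_surjective _ Ideal.Quotient.mk_surjective)
      have hdle := le_ringKrullDim_of_injective_of_isIntegral _ hint hinj'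
      rw [MvPolynomial.ringKrullDim_of_isNoetherianRing, ringKrullDim_eq_zero_of_field, zero_add,
        Nat.card_eq_fintype_card, Fintype.card_fin] at hdle
      have hqQ : (⟨q, hqp⟩ : PrimeSpectrum B) ∈ Q := by
        rw [hQdef, Set.Finite.mem_toFinset]
        exact ⟨mem_minimalPrimes_of_ringKrullDim_le hdim hdle,
          le_antisymm ((_root_.ringKrullDim_quotient_le q).trans hdim.le) hdle⟩
      -- The dimension is at most d + s, then s after the x's, then 0 after the y's.
      have hbot : derivationsVanishingOn k ⟨q, hqp⟩
          (Set.range (fun j => (y j : B)) ∪ Set.range (fun j => (x j : B))) = ⊥ := by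
        have := (hQ _ hqQ).1
        have h1 := hyQ _ hqQ
        have h2 := hxQ _ hqQ
        exact Submodule.finrank_eq_zero.mp (by omega)
      let : Algebra k F := ((algebraMap P F).comp (algebraMap k P)).toAlgebra
      have hkPF : IsScalarTower k P F := IsScalarTower.of_algebraMap_eq fun _ => rfl
      have hkBF : IsScalarTower k B F := IsScalarTower.of_algebraMap_eq fun c => by
        rw [IsScalarTower.algebraMap_apply k P F, IsScalarTower.algebraMap_apply P B F,
          ← IsScalarTower.algebraMap_apply k P B]
      have hD0 : D.restrictScalars k = 0 := by
        refine derivation_eq_zero_of_residueField q (fun b => Iff.rfl)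
          (Set.range (fun j => (y j : B)) ∪ Set.range (fun j => (x j : B))) (fun E hE => ?_) _ ?_
        · have : E ∈ derivationsVanishingOn k ⟨q, hqp⟩
            (Set.range (fun j => (y j : B)) ∪ Set.range (fun j => (x j : B))) := hE
          rw [hbot] at this
          exact this
        · rintro _ (⟨j, rfl⟩ | ⟨j, rfl⟩)
          · exact hD j
          · have h1 : (x j : B) = algebraMap P B (MvPolynomial.X j) :=
              (MvPolynomial.aeval_X (fun j => (x j : B)) j).symm
            change D (x j : B) = 0
            rw [h1]
            exact D.map_algebraMap _
      ext b
      exact Derivation.congr_fun hD0 b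
    · intro α β hαβ
      exact AlgHom.restrictScalars_injective k (hyZ _ ⟨α, rfl⟩ _ ⟨β, rfl⟩ hαβ)
  refine ⟨f, hf, ?_⟩
  rw [Algebra.smul_def] at hfb
  refine mem_of_mem_adjoin _ (fun p => ?_) ?_ hfb
  · have h1 : φ p ∈ Algebra.adjoin k (Set.range fun j => (x j : B)) := by
      rw [Algebra.adjoin_range_eq_range_aeval]
      exact ⟨p, rfl⟩
    exact Algebra.adjoin_mono Set.subset_union_left h1
  · exact Set.subset_union_right.trans Algebra.subset_adjoin

end Existence

/-! ### From generic generators to the reduction condition -/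

section GenericForms

variable {k B : Type*} [Field k] [CommRing B] [Algebra k B]

/-- Multiply the f's belonging to finitely many module generators. -/
theorem exists_uniform_mul_mem {σ : Type*} (φ : MvPolynomial σ k →ₐ[k] B)
    (hfin : φ.toRingHom.Finite) (C : Subalgebra k B) (hφ : ∀ p, φ p ∈ C)
    (h : ∀ b, ∃ f, f ≠ 0 ∧ φ f * b ∈ C) : ∃ f, f ≠ 0 ∧ ∀ b, φ f * b ∈ C := by
  classical
  let : Algebra (MvPolynomial σ k) B := φ.toRingHom.toAlgebra
  have hf : Module.Finite (MvPolynomial σ k) B := hfin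
  obtain ⟨S, hS⟩ := Module.finite_def.mp hf
  choose f hf0 hfC using h
  refine ⟨∏ g ∈ S, f g, Finset.prod_ne_zero_iff.mpr fun g _ => hf0 g, fun b => ?_⟩
  have hb : b ∈ Submodule.span (MvPolynomial σ k) (S : Set B) := by
    rw [hS]
    trivial
  induction hb using Submodule.span_induction with
  | mem g hg =>
    rw [← Finset.prod_erase_mul S f hg, map_mul, mul_assoc]
    exact mul_mem (hφ _) (hfC g)
  | zero => rw [mul_zero]; exact zero_mem _
  | add y z _ _ hy hz => rw [mul_add]; exact add_mem hy hz
  | smul p y _ hy =>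
    rw [Algebra.smul_def, mul_left_comm]
    exact mul_mem (hφ p) hy

theorem MvPolynomial.IsHomogeneous.aeval_smul {σ : Type*} {f : MvPolynomial σ k} {e : ℕ}
    (hf : f.IsHomogeneous e) (c : σ → k) (w : B) :
    MvPolynomial.aeval (fun i => c i • w) f = MvPolynomial.eval c f • w ^ e := by
  rw [MvPolynomial.aeval_def, MvPolynomial.eval₂_eq, MvPolynomial.eval_eq, Finset.sum_smul]
  refine Finset.sum_congr rfl fun m hm => ?_
  have hme : ∑ i ∈ m.support, m i = e := by
    have := hf (MvPolynomial.mem_support_iff.mp hm)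
    change Finsupp.weight (fun _ => 1) m = e at this
    rwa [← Finsupp.degree_eq_weight_one] at this
  simp_rw [smul_pow]
  rw [Finset.prod_smul, Finset.prod_pow_eq_pow_sum, hme, mul_smul, ← Algebra.smul_def]

variable {𝒜 : ℕ → Submodule k B} [GradedAlgebra 𝒜]

theorem MvPolynomial.IsHomogeneous.aeval_mem_graded {σ : Type*} {f : MvPolynomial σ k} {e : ℕ}
    (hf : f.IsHomogeneous e) {x : σ → B} (hx : ∀ i, x i ∈ 𝒜 1) :
    MvPolynomial.aeval x f ∈ 𝒜 e := by
  rw [MvPolynomial.aeval_def, MvPolynomial.eval₂_eq]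
  refine sum_mem fun m hm => ?_
  have hme : ∑ i ∈ m.support, m i = e := by
    have := hf (MvPolynomial.mem_support_iff.mp hm)
    change Finsupp.weight (fun _ => 1) m = e at this
    rwa [← Finsupp.degree_eq_weight_one] at this
  rw [← Algebra.smul_def]
  refine Submodule.smul_mem _ _ ?_
  have := SetLike.prod_pow_mem_graded 𝒜 (fun _ => 1) x m (F := m.support)
    fun i _ => hx i
  simpa [hme] using this

theorem proj_aeval {σ : Type*} {x : σ → B} (hx : ∀ i, x i ∈ 𝒜 1) (f : MvPolynomial σ k) (e : ℕ) :
    GradedRing.proj 𝒜 e (MvPolynomial.aeval x f) =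
      MvPolynomial.aeval x (MvPolynomial.homogeneousComponent e f) := by
  have hmem : ∀ i, MvPolynomial.aeval x (MvPolynomial.homogeneousComponent i f) ∈ 𝒜 i := fun i =>
    (MvPolynomial.homogeneousComponent_isHomogeneous i f).aeval_mem_graded hx
  conv_lhs => rw [← MvPolynomial.sum_homogeneousComponent f]
  rw [map_sum, map_sum, Finset.sum_eq_single e]
  · exact proj_of_mem (hmem e)
  · exact fun i _ hi => proj_of_mem_ne (hmem i) hi
  · intro he
    rw [proj_of_mem (hmem e), MvPolynomial.homogeneousComponent_eq_zero e f
      (by simpa using he), map_zero]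

/-- The algebra generated by forms of degree one is closed under taking homogeneous components, so f
may be replaced by any nonzero component. -/
theorem exists_isHomogeneous_mul_mem {σ : Type*} {x : σ → B} (hx : ∀ i, x i ∈ 𝒜 1)
    {L : Submodule k B} (hL : L ≤ 𝒜 1) {f : MvPolynomial σ k} (hf : f ≠ 0)
    (h : ∀ b, MvPolynomial.aeval x f * b ∈ Algebra.adjoin k (L : Set B)) :
    ∃ (e : ℕ) (g : MvPolynomial σ k), g.IsHomogeneous e ∧ g ≠ 0 ∧
      ∀ b, MvPolynomial.aeval x g * b ∈ Algebra.adjoin k (L : Set B) := by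
  obtain ⟨e, he⟩ : ∃ e, MvPolynomial.homogeneousComponent e f ≠ 0 := by
    by_contra! h0
    exact hf (by rw [← MvPolynomial.sum_homogeneousComponent f]; simp [h0])
  refine ⟨e, _, MvPolynomial.homogeneousComponent_isHomogeneous e f, he, fun b => ?_⟩
  induction b using DirectSum.Decomposition.inductionOn 𝒜 with
  | zero => rw [mul_zero]; exact zero_mem _
  | @homogeneous j b =>
    have h1 := proj_mem_pow_of_mem_adjoin hL (h b) (e + j)
    rw [GradedRing.proj_apply, DirectSum.coe_decompose_mul_add_of_right_mem 𝒜 b.2,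
      ← GradedRing.proj_apply, proj_aeval hx] at h1
    exact pow_le_adjoin L _ h1
  | add y z hy hz => rw [mul_add]; exact add_mem hy hz

/-- Pick a point where f · X_{i₀} is nonzero and rescale; homogeneity keeps f nonzero there. -/
theorem exists_eval_ne_zero_of_isHomogeneous [Infinite k] {σ : Type*} {f : MvPolynomial σ k}
    {e : ℕ} (hf : f.IsHomogeneous e) (hf0 : f ≠ 0) (i₀ : σ) :
    ∃ c : σ → k, c i₀ = 1 ∧ MvPolynomial.eval c f ≠ 0 := by
  obtain ⟨a, ha⟩ : ∃ a, MvPolynomial.eval a (f * MvPolynomial.X i₀) ≠ 0 := by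
    by_contra! h
    exact mul_ne_zero hf0 (MvPolynomial.X_ne_zero i₀)
      (MvPolynomial.funext fun a => by rw [h a, map_zero])
  rw [map_mul, MvPolynomial.eval_X] at ha
  have ha0 := right_ne_zero_of_mul ha
  refine ⟨fun i => a i / a i₀, div_self ha0, fun h => left_ne_zero_of_mul ha ?_⟩
  have h1 := hf.aeval_smul (fun i => a i / a i₀) (a i₀)
  rw [h, zero_smul] at h1
  have ha' : (fun i => (a i / a i₀) • a i₀) = a := funext fun i => div_mul_cancel₀ (a i) ha0
  rwa [ha', MvPolynomial.aeval_eq_eval] at h1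

/-- Some 𝔪^N lies in the ideal generated by X, so each further degree costs one factor from X. -/
theorem IsStandardGraded.exists_pow_mul_eq (hB : IsStandardGraded 𝒜) {X : Submodule k B}
    (hX : X ≤ 𝒜 1)
    (hm : (HomogeneousIdeal.irrelevant 𝒜).toIdeal ≤ (Ideal.span (X : Set B)).radical) :
    ∃ N, ∀ e m, N ≤ m → 𝒜 (m + e) ≤ 𝒜 m * X ^ e := by
  have := hB.isNoetherianRing
  obtain ⟨N, hN⟩ := Ideal.exists_pow_le_of_le_radical_of_fg hm (IsNoetherian.noetherian _)
  rw [hB.irrelevant_pow] at hN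
  have h1 : ∀ m, N ≤ m → 𝒜 (m + 1) ≤ 𝒜 m * X := by
    intro m hNm b hb
    refine mem_mul_of_mem_span hX ?_ hb
    obtain ⟨j, hj⟩ : ∃ j, m + 1 = j + N := ⟨m + 1 - N, by omega⟩
    rw [hj, ← hB.graded_mul_eq] at hb
    refine Submodule.mul_induction_on hb (fun u _ v hv => ?_) fun u v hu hv => add_mem hu hv
    exact Ideal.mul_mem_left _ _ (hN (Ideal.subset_span hv))
  refine ⟨N, fun e m hNm => ?_⟩
  induction e with
  | zero => rw [pow_zero, mul_one, add_zero]
  | succ e ih =>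
    rw [pow_succ, ← mul_assoc]
    exact (h1 (m + e) (by omega)).trans (mul_le_mul' ih le_rfl)

/-- If `J`, `Y` are spaces of linear forms such that `X` is, modulo `J`, spanned by one form of `Y`,
and `k[X, Y]` contains a multiple of `B` by a form on `X` not vanishing modulo `J`, then `Y`
generates `B` modulo `J` in large degrees. -/
theorem IsStandardGraded.exists_graded_le (hB : IsStandardGraded 𝒜) {σ : Type*} {x : σ → B}
    (hx : ∀ i, x i ∈ 𝒜 1)
    (hm : (HomogeneousIdeal.irrelevant 𝒜).toIdeal ≤ (Ideal.span (Set.range x)).radical)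
    {J Y : Submodule k B} (hJ : J ≤ 𝒜 1) (hY : Y ≤ 𝒜 1) {w : B} (hw : w ∈ Y) {c : σ → k}
    (hxJ : ∀ i, x i - c i • w ∈ J) {f : MvPolynomial σ k} {e : ℕ} (hf : f.IsHomogeneous e)
    (hfc : MvPolynomial.eval c f ≠ 0)
    (h : ∀ b, MvPolynomial.aeval x f * b ∈ Algebra.adjoin k (Set.range x ∪ Y)) :
    ∃ n, 𝒜 (n + 1) ≤ J * 𝒜 n ⊔ Y ^ (n + 1) := by
  set I : Ideal B := Ideal.span (J : Set B) with hI
  let π := Ideal.Quotient.mkₐ k I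
  let T : Subalgebra k B := ((Algebra.adjoin k (Y : Set B)).map π).comap π
  have hYT : ∀ b ∈ Algebra.adjoin k (Y : Set B), b ∈ T := fun b hb => ⟨b, hb, rfl⟩
  have hπx : ∀ i, π (x i) = c i • π w := by
    intro i
    rw [← sub_eq_zero, ← map_smul, ← map_sub]
    exact Ideal.Quotient.eq_zero_iff_mem.mpr (Ideal.subset_span (hxJ i))
  have hwT : π w ∈ (Algebra.adjoin k (Y : Set B)).map π := ⟨w, Algebra.subset_adjoin hw, rfl⟩
  have hXYT : Algebra.adjoin k (Set.range x ∪ Y) ≤ T := by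
    refine Algebra.adjoin_le (Set.union_subset ?_ fun y hy => hYT y (Algebra.subset_adjoin hy))
    rintro _ ⟨i, rfl⟩
    change π (x i) ∈ (Algebra.adjoin k (Y : Set B)).map π
    rw [hπx]
    exact Subalgebra.smul_mem _ hwT _
  set X := Submodule.span k (Set.range x) with hXdef
  have hX : X ≤ 𝒜 1 := Submodule.span_le.mpr (by rintro _ ⟨i, rfl⟩; exact hx i)
  have hXw : X ≤ (Submodule.span k {π w}).comap π.toLinearMap := by
    refine Submodule.span_le.mpr ?_
    rintro _ ⟨i, rfl⟩
    change π (x i) ∈ Submodule.span k {π w}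
    rw [hπx]
    exact Submodule.smul_mem _ _ (Submodule.mem_span_singleton_self _)
  have hXe : ∀ t ∈ X ^ e, ∃ r : k, r • π w ^ e = π t := by
    intro t ht
    rw [← Submodule.mem_span_singleton, ← Set.singleton_pow, ← Submodule.span_pow]
    have h1 : (X ^ e).map π.toLinearMap ≤ Submodule.span k {π w} ^ e := by
      rw [Submodule.map_pow]
      exact pow_le_pow_left' (Submodule.map_le_iff_le_comap.mpr hXw) e
    exact h1 ⟨t, ht, rfl⟩
  have hπf : π (MvPolynomial.aeval x f) = MvPolynomial.eval c f • π w ^ e := by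
    rw [← AlgHom.comp_apply, MvPolynomial.comp_aeval, ← hf.aeval_smul]
    simp_rw [hπx]
  rw [← ideal_span_submodule_span (k := k)] at hm
  obtain ⟨N, hN⟩ := hB.exists_pow_mul_eq hX hm
  refine ⟨N + e, fun b hb => ?_⟩
  have hbT : b ∈ T := by
    -- Write b as a sum of products a t with t ∈ X^e. Modulo J, t is a scalar multiple of w^e and
    -- f(x) is f(c) w^e with f(c) ≠ 0, so a t is a scalar multiple of f(x) a, which lies in k[Y] +
    -- JB.
    have hb' := hN e (N + 1) (by omega) (by rwa [show N + 1 + e = N + e + 1 by omega])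
    refine Submodule.mul_induction_on hb' (fun a _ t ht => ?_) fun u v hu hv => add_mem hu hv
    obtain ⟨r, hr⟩ := hXe t ht
    have h1 : π (a * t) =
        (r * (MvPolynomial.eval c f)⁻¹) • π (MvPolynomial.aeval x f * a) := by
      rw [map_mul, map_mul, hπf, ← hr, smul_mul_assoc, smul_smul, mul_assoc,
        inv_mul_cancel₀ hfc, mul_one, mul_smul_comm, mul_comm]
    change π (a * t) ∈ (Algebra.adjoin k (Y : Set B)).map π
    rw [h1]
    exact Subalgebra.smul_mem _ (hXYT (h a)) _
  obtain ⟨y, hy, hyb⟩ := hbT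
  have hyI : b - y ∈ I := Ideal.Quotient.eq.mp hyb.symm
  have h1 := proj_mem_mul_of_mem_span hJ hyI (N + e)
  have h2 := proj_mem_pow_of_mem_adjoin hY hy (N + e + 1)
  have h3 : GradedRing.proj 𝒜 (N + e + 1) (b - y) + GradedRing.proj 𝒜 (N + e + 1) y = b := by
    rw [← map_add, sub_add_cancel, proj_of_mem hb]
  rw [mul_comm, ← h3]
  exact Submodule.add_mem_sup h1 h2

theorem IsStandardGraded.exists_forms_graded_le [Infinite k] [PerfectField k]
    (hB : IsStandardGraded 𝒜) {d s : ℕ} (hd : 1 ≤ d) (hs : 1 ≤ s) (hdim : ringKrullDim B = d)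
    (hemb : ∀ (q : Ideal B) [q.IsPrime], q ∈ minimalPrimes B → ringKrullDim (B ⧸ q) = d →
      embeddingDimension (Localization.AtPrime q) ≤ s) :
    ∃ (z : Fin (d + s) → 𝒜 1) (n : ℕ), 𝒜 (n + 1) ≤
      Submodule.span k {b : B | ∃ i : Fin (d + s), (i : ℕ) + 1 < d ∧ b = z i} * 𝒜 n ⊔
        Submodule.span k {b : B | ∃ i : Fin (d + s), d ≤ (i : ℕ) + 1 ∧ b = z i} ^ (n + 1) := by
  obtain ⟨x, y, hm, hgen⟩ := hB.exists_generic_generators hs hdim hemb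
  have hx : ∀ i, (x i : B) ∈ 𝒜 1 := fun i => (x i).2
  obtain ⟨f, hf, hfC⟩ := exists_uniform_mul_mem _ (hB.finite_aeval hx hm) _ (fun p => by
    have h1 : MvPolynomial.aeval (fun j => (x j : B)) p ∈
        Algebra.adjoin k (Set.range fun j => (x j : B)) := by
      rw [Algebra.adjoin_range_eq_range_aeval]
      exact ⟨p, rfl⟩
    exact Algebra.adjoin_mono Set.subset_union_left h1) hgen
  rw [← Algebra.adjoin_span] at hfC
  obtain ⟨e, g, hg, hg0, hgC⟩ := exists_isHomogeneous_mul_mem hx (Submodule.span_le.mpr (by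
    rintro _ (⟨i, rfl⟩ | ⟨i, rfl⟩)
    · exact (x i).2
    · exact (y i).2)) hf hfC
  rw [Algebra.adjoin_span] at hgC
  let l : Fin d := ⟨d - 1, by omega⟩
  obtain ⟨c, hcl, hc⟩ := exists_eval_ne_zero_of_isHomogeneous hg hg0 l
  -- The first d - 1 entries are the x_i - c_i x_l and span J; x_l and the y's fill the remaining s
  -- + 1 places and span Y.
  let z : Fin (d + s) → 𝒜 1 := Fin.append (fun i => if i = l then x l else x i - c i • x l) y
  have hz : ∀ p : Fin (d + s) → Prop,
      Submodule.span k {b : B | ∃ i, p i ∧ b = z i} ≤ 𝒜 1 := by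
    refine fun p => Submodule.span_le.mpr ?_
    rintro _ ⟨i, -, rfl⟩
    exact (z i).2
  refine ⟨z, hB.exists_graded_le hx hm (hz _) (hz _) (w := (x l : B)) ?_ (c := c) (fun i => ?_)
    hg hc fun b => Algebra.adjoin_mono (Set.union_subset_union_right _ ?_) (hgC b)⟩
  · refine Submodule.subset_span ⟨Fin.castAdd s l, ?_, ?_⟩
    · simp only [Fin.val_castAdd, l]
      omega
    · simp [z]
  · by_cases hi : i = l
    · rw [hi, hcl, one_smul, sub_self]
      exact zero_mem _
    · refine Submodule.subset_span ⟨Fin.castAdd s i, ?_, ?_⟩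
      · have : (i : ℕ) ≠ d - 1 := fun h => hi (Fin.ext h)
        simp only [Fin.val_castAdd]
        omega
      · simp [z, hi]
  · rintro _ ⟨j, rfl⟩
    refine Submodule.subset_span ⟨Fin.natAdd d j, ?_, ?_⟩
    · simp only [Fin.val_natAdd]
      omega
    · simp [z]

end GenericForms

theorem proposition2p5 {k B : Type*} [Field k] [Infinite k] [PerfectField k]
    [CommRing B] [Algebra k B] (𝒜 : ℕ → Submodule k B) [GradedAlgebra 𝒜]
    (hB : IsStandardGraded 𝒜) (d s : ℕ) (hd : 1 ≤ d) (hs : 1 ≤ s)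
    (hdim : ringKrullDim B = d) :
    HoldsForGeneral k (fun x : Fin (d + s) → 𝒜 1 =>
      -- the coordinate `x i` is the form with index `i + 1` when counting from 1
      (∀ᶠ n : ℕ in atTop,
        (HomogeneousIdeal.irrelevant 𝒜).toIdeal ^ n =
          Ideal.span {b : B | ∃ i : Fin (d + s), (i : ℕ) + 1 < d ∧ b = x i} *
              (HomogeneousIdeal.irrelevant 𝒜).toIdeal ^ (n - 1) +
            Ideal.span {b : B | ∃ i : Fin (d + s), d ≤ (i : ℕ) + 1 ∧ b = x i} ^ n) ↔
      ∀ (q : Ideal B) [q.IsPrime], q ∈ minimalPrimes B → ringKrullDim (B ⧸ q) = d →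
        embeddingDimension (Localization.AtPrime q) ≤ s) := by
  have hle : ∀ (x : Fin (d + s) → 𝒜 1) (p : Fin (d + s) → Prop),
      Submodule.span k {b : B | ∃ i, p i ∧ b = x i} ≤ 𝒜 1 := by
    refine fun x p => Submodule.span_le.mpr ?_
    rintro _ ⟨i, -, rfl⟩
    exact (x i).2
  by_cases hemb : ∀ (q : Ideal B) [q.IsPrime], q ∈ minimalPrimes B → ringKrullDim (B ⧸ q) = d →
      embeddingDimension (Localization.AtPrime q) ≤ s
  · obtain ⟨z, n, hz⟩ := hB.exists_forms_graded_le hd hs hdim hemb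
    obtain ⟨U, hU, hzU, hUn⟩ := hB.exists_isZariskiOpen _ _ n hz
    refine ⟨U, hU, ⟨z, hzU⟩, fun v hv => iff_of_true ?_ hemb⟩
    have h := hB.eventually_of_le (hle v _) (hle v _) (hUn v hv)
    simpa only [ideal_span_submodule_span] using h
  -- If some embedding dimension exceeds s, the reduction condition fails for every tuple, so the
  -- whole space serves as U.
  · refine ⟨Set.univ, ⟨{1}, by simp [polyEval]⟩, Set.univ_nonempty, fun v _ =>
      iff_of_false (fun h => hemb fun q _ hq hqd => ?_) hemb⟩
    obtain ⟨N, hN⟩ := eventually_atTop.mp h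
    refine hB.embeddingDimension_le hd (fun i => (v i).2) (n := N) (fun m hm => ?_) q hq hqd
    refine (hB.irrelevant_pow_eq_iff (hle v _) (hle v _) m).mp ?_
    simpa only [ideal_span_submodule_span, Nat.add_sub_cancel] using hN (m + 1) (by omega)
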